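/- **Setting.** Let $\mathcal O\subseteq\mathbb R^d$ be Borel, $P^X$ a Borel probability measure on $\mathcal O$, $\Theta$ a linear subspace of $\ell_2(\mathbb N)$ containing $\mathbb R^D$ as a linear subspace, $\mathcal G:\Theta\to C(\mathcal O)$ a map into the continuous real-valued functions, and $\theta_0\in\Theta$. Let $P_{\theta_0}$ be the law of $Z=(Y,X)$, where $Y=\mathcal G(\theta_0)(X)+\varepsilon$, $X\sim P^X$, and $\varepsilon\sim N(0,1)$ is independent of $X$; let $P_{\theta_0}^N=\otimes_{i=1}^N P_{\theta_0}$ be the law of $Z^{(N)}=(Z_1,\dots,Z_N)$, $Z_i=(Y_i,X_i)$. For $\theta\in\mathbb R^D$ put $$\ell(\theta,Z)=-\tfrac12[Y-\mathcal G(\theta)(X)]^2,\qquad \ell_N(\theta)=\ell_N(\theta,Z^{(N)})=-\tfrac12\sum_{i=1}^N[Y_i-\mathcal G(\theta)(X_i)]^2 .$$ Gradients $\nabla$ and Hessians $\nabla^2$ are taken in $\theta\in\mathbb R^D$, $\|\cdot\|$ is the Euclidean norm, $\|\cdot\|_{op}$ the corresponding operator norm, and $\lambda_{min}$ the smallest eigenvalue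 of a symmetric matrix. Let $\eta>0$, $\theta^*\in\mathbb R^D$, $M\in\mathbb R^{D\times D}$ symmetric positive definite, $|\theta|_1=\sqrt{\theta^TM\theta}$ and $\mathcal B=\{\theta\in\mathbb R^D:|\theta-\theta^*|_1<\eta\}$. **Local regularity.** For every $x\in\mathcal O$ the map $\theta\mapsto\mathcal G(\theta)(x)$ is twice continuously differentiable on $\mathcal B$, and for some $k_0,k_1,k_2,m_0,m_1,m_2>0$, all $\theta,\bar\theta\in\mathcal B$ and all $x\in\mathcal O$, $$|\mathcal G(\theta)(x)-\mathcal G(\theta_0)(x)|\le k_0,\quad \|\nabla\mathcal G(\theta)(x)\|\le k_1,\quad \|\nabla^2\mathcal G(\theta)(x)\|_{op}\le k_2,$$ $$|\mathcal G(\theta)(x)-\mathcal G(\bar\theta)(x)|\le m_0|\theta-\bar\theta|_1,\quad \|\nabla\mathcal G(\theta)(x)-\nabla\mathcal G(\bar\theta)(x)\|\le m_1|\theta-\bar\theta|_1,\quad \|\nabla^2\mathcal G(\theta)(x)-\nabla^2\mathcal G(\bar\theta)(x)\|_{op}\le m_2|\theta-\bar\theta|_1 .$$ **Local curvature.** For some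 $c_{max}\ge c_{min}>0$ and all $\theta\in\mathcal B$, $$\lambda_{min}\big(E_{\theta_0}[-\nabla^2\ell(\theta,Z)]\big)\ge c_{min},\qquad |E_{\theta_0}\ell(\theta,Z)|+\|E_{\theta_0}[\nabla\ell(\theta,Z)]\|+\|E_{\theta_0}[\nabla^2\ell(\theta,Z)]\|_{op}\le c_{max}.$$ **Lemma 3.4.** There is a universal constant $C>0$ such that in every such setting, with $$C_{\mathcal G}=k_0m_2+k_1m_1+k_2m_0+m_2,\quad C_{\mathcal G}'=k_1^2+k_0k_2+k_2,$$ $$C_{\mathcal G}''=k_0m_1+k_1m_0+m_1+k_0m_0+m_0,\quad C_{\mathcal G}'''=k_0k_1+k_1+k_0^2+k_0,$$ $$\mathcal R_N=CN\min\Big\{\frac{c_{min}^2}{C_{\mathcal G}^2\eta^2},\frac{c_{min}}{C_{\mathcal G}\eta},\frac{c_{min}^2}{C_{\mathcal G}'^2},\frac{c_{min}}{k_2},\frac{c_{max}^2}{C_{\mathcal G}''^2\eta^2},\frac{c_{max}}{C_{\mathcal G}''\eta},\frac{c_{max}^2}{C_{\mathcal G}'''^2},\frac{c_{max}}{k_0+k_1}\Big\},$$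 the following holds for all integers $D,N\ge1$ with $D\le\mathcal R_N$: $$P_{\theta_0}^N\Big(\inf_{\theta\in\mathcal B}\lambda_{min}[-\nabla^2\ell_N(\theta)]<\tfrac12Nc_{min}\Big)\le 8e^{-\mathcal R_N},$$ $$P_{\theta_0}^N\Big(\sup_{\theta\in\mathcal B}\big[|\ell_N(\theta)|+\|\nabla\ell_N(\theta)\|+\|\nabla^2\ell_N(\theta)\|_{op}\big]>N(5c_{max}+1)\Big)\le 24e^{-\mathcal R_N}+e^{-N/8}.$$ -/

import Mathlib

open MeasureTheory ProbabilityTheory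

noncomputable section

namespace RandomDesign

/-- The sequence space `ℓ₂(ℕ)`. -/
abbrev EllTwo : Type := lp (fun _ : ℕ => ℝ) 2

/-- `ℝ^D` with its Euclidean norm. -/
abbrev E (D : ℕ) : Type := EuclideanSpace ℝ (Fin D)

/-- The Hessian `∇² f (θ)`, as the linear map `ℝ^D → ℝ^D` obtained by differentiating `∇ f`.
Its norm in `E D →L[ℝ] E D` is the operator norm for the Euclidean norm. -/
def hess {D : ℕ} (f : E D → ℝ) (θ : E D) : E D →L[ℝ] E D :=
  fderiv ℝ (gradient f) θ

/-- The smallest (real) eigenvalue; only used for symmetric `A` and `1 ≤ D`, where the set of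
eigenvalues is finite and non-empty. -/
def lambdaMin {D : ℕ} (A : E D →L[ℝ] E D) : ℝ :=
  sInf {μ : ℝ | Module.End.HasEigenvalue (A : E D →ₗ[ℝ] E D) μ}

/-- The ellipsoidal norm `|θ|₁ = √(θᵀ M θ)` with matrix `M`. -/
def ellNorm {D : ℕ} (M : Matrix (Fin D) (Fin D) ℝ) (θ : E D) : ℝ :=
  √(θ.ofLp ⬝ᵥ (M.mulVec θ.ofLp))

/-- The region `B = {θ : |θ - θ*|₁ < η}`. -/
def ellBall {D : ℕ} (M : Matrix (Fin D) (Fin D) ℝ) (θs : E D) (η : ℝ) : Set (E D) :=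
  {θ | ellNorm M (θ - θs) < η}

section Model

variable {d : ℕ} {O : Set (EuclideanSpace ℝ (Fin d))}

/-- The law `P_θ` of one observation `Z = (Y, X)`, `Y = g X + ε`, where `g = G(θ)` is the regression
function, `X ∼ P^X` and `ε ∼ N(0,1)` is independent of `X`. -/
def obsLaw (PX : Measure O) (g : C(O, ℝ)) : Measure (ℝ × O) :=
  (PX.prod (gaussianReal 0 1)).map (fun p => (g p.1 + p.2, p.1))

/-- The law `P_θ^N` of the data `Z^(N) = (Z_1, …, Z_N)`, the `Z_i` being i.i.d. from `P_θ`. -/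
def dataLaw (PX : Measure O) (g : C(O, ℝ)) (N : ℕ) : Measure (Fin N → ℝ × O) :=
  Measure.pi (fun _ => obsLaw PX g)

variable {D : ℕ}

/-- The log-likelihood `ℓ(θ, z)` of one observation `z = (y, x)`; here `F : ℝ^D → C(O)` is the
restriction of the forward map to `ℝ^D`. -/
def logLik (F : E D → C(O, ℝ)) (θ : E D) (z : ℝ × O) : ℝ :=
  -(1 / 2) * (z.1 - F θ z.2) ^ 2

/-- The log-likelihood `ℓ_N(θ, z)` of the data `z = (z_1, …, z_N)`. -/
def logLikN {N : ℕ} (F : E D → C(O, ℝ)) (θ : E D) (z : Fin N → ℝ × O) : ℝ :=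
  -(1 / 2) * ∑ i, ((z i).1 - F θ (z i).2) ^ 2

/-- `∇ G(θ)(x)`, the gradient in `θ`. -/
def gradF (F : E D → C(O, ℝ)) (θ : E D) (x : O) : E D :=
  gradient (fun t => F t x) θ

/-- `∇² G(θ)(x)`, the Hessian in `θ`. -/
def hessF (F : E D → C(O, ℝ)) (θ : E D) (x : O) : E D →L[ℝ] E D :=
  hess (fun t => F t x) θ

/-- Local regularity of the forward map on `B = {θ : |θ - θ*|₁ < η}`, with `g0 = G(θ₀)`. The
functional norms are suprema over `x ∈ O`, so the bounds are written pointwise in `θ` and `x`. -/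
structure LocalRegularity (F : E D → C(O, ℝ)) (g0 : C(O, ℝ))
    (M : Matrix (Fin D) (Fin D) ℝ) (θs : E D) (η k0 k1 k2 m0 m1 m2 : ℝ) : Prop where
  contDiffOn : ∀ x : O, ContDiffOn ℝ 2 (fun θ => F θ x) (ellBall M θs η)
  k0_pos : 0 < k0
  k1_pos : 0 < k1
  k2_pos : 0 < k2
  m0_pos : 0 < m0
  m1_pos : 0 < m1
  m2_pos : 0 < m2
  bound0 : ∀ θ ∈ ellBall M θs η, ∀ x : O, |F θ x - g0 x| ≤ k0
  bound1 : ∀ θ ∈ ellBall M θs η, ∀ x : O, ‖gradF F θ x‖ ≤ k1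
  bound2 : ∀ θ ∈ ellBall M θs η, ∀ x : O, ‖hessF F θ x‖ ≤ k2
  lip0 : ∀ θ ∈ ellBall M θs η, ∀ θ' ∈ ellBall M θs η, ∀ x : O,
    |F θ x - F θ' x| ≤ m0 * ellNorm M (θ - θ')
  lip1 : ∀ θ ∈ ellBall M θs η, ∀ θ' ∈ ellBall M θs η, ∀ x : O,
    ‖gradF F θ x - gradF F θ' x‖ ≤ m1 * ellNorm M (θ - θ')
  lip2 : ∀ θ ∈ ellBall M θs η, ∀ θ' ∈ ellBall M θs η, ∀ x : O,
    ‖hessF F θ x - hessF F θ' x‖ ≤ m2 * ellNorm M (θ - θ')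

/-- Local average curvature on `B = {θ : |θ - θ*|₁ < η}`; the expectation `E_{θ₀}` is taken under
`obsLaw PX g0` with `g0 = G(θ₀)`. -/
structure LocalCurvature (PX : Measure O) (F : E D → C(O, ℝ)) (g0 : C(O, ℝ))
    (M : Matrix (Fin D) (Fin D) ℝ) (θs : E D) (η cmin cmax : ℝ) : Prop where
  cmin_pos : 0 < cmin
  cmin_le_cmax : cmin ≤ cmax
  lower : ∀ θ ∈ ellBall M θs η,
    cmin ≤ lambdaMin (∫ z, -hess (fun t => logLik F t z) θ ∂(obsLaw PX g0))
  upper : ∀ θ ∈ ellBall M θs η,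
    |∫ z, logLik F θ z ∂(obsLaw PX g0)|
      + ‖∫ z, gradient (fun t => logLik F t z) θ ∂(obsLaw PX g0)‖
      + ‖∫ z, hess (fun t => logLik F t z) θ ∂(obsLaw PX g0)‖ ≤ cmax

end Model

/-- `C_G`. -/
def CG (k0 k1 k2 m0 m1 m2 : ℝ) : ℝ := k0 * m2 + k1 * m1 + k2 * m0 + m2

/-- `C_G'`. -/
def CG' (k0 k1 k2 : ℝ) : ℝ := k1 ^ 2 + k0 * k2 + k2

/-- `C_G''`. -/
def CG'' (k0 k1 m0 m1 : ℝ) : ℝ := k0 * m1 + k1 * m0 + m1 + k0 * m0 + m0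

/-- `C_G'''`. -/
def CG''' (k0 k1 : ℝ) : ℝ := k0 * k1 + k1 + k0 ^ 2 + k0

/-- The rate `R_N`: `C N` times the minimum of eight terms. -/
def rateR (C : ℝ) (N : ℕ) (η k0 k1 k2 m0 m1 m2 cmin cmax : ℝ) : ℝ :=
  C * N *
    min (cmin ^ 2 / ((CG k0 k1 k2 m0 m1 m2) ^ 2 * η ^ 2))
    (min (cmin / (CG k0 k1 k2 m0 m1 m2 * η))
    (min (cmin ^ 2 / (CG' k0 k1 k2) ^ 2)
    (min (cmin / k2)
    (min (cmax ^ 2 / ((CG'' k0 k1 m0 m1) ^ 2 * η ^ 2))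
    (min (cmax / (CG'' k0 k1 m0 m1 * η))
    (min (cmax ^ 2 / (CG''' k0 k1) ^ 2)
      (cmax / (k0 + k1))))))))

end RandomDesign

end

/-!
Apart from the sum of squared noise variables, which does not depend on `θ`, every fluctuation in
this problem is sub-Gaussian, so plain Hoeffding bounds and dyadic chaining suffice and no
Bernstein-type inequality is needed.

Write `ε = Y - G(θ₀)(X)` for the noise. For fixed vectors `v`, `w`, each of
`ℓ(θ, Z) + ε² / 2`, `⟪∇ℓ(θ, Z), v⟫` and `⟪∇²ℓ(θ, Z) v, w⟫` is affine in the noise, of the form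
`ε a_θ(X) + b_θ(X)`, where by local regularity `a_θ` and `b_θ` are bounded at the centre `θ*` and
Lipschitz in `θ` for the ellipsoidal norm, uniformly in `x`. Such a variable, centred, is
sub-Gaussian (`hasSubgaussianMGF_noiseAffine`): the first summand by the Gaussian moment generating
function given `X`, the second by Hoeffding's lemma. Hence sums over the sample are sub-Gaussian
processes in `θ`, and chaining over the ellipsoid, which is a linear image of the Euclidean unit
ball, gives `measure_exists_ellBall_empDev_gt_le`: with probability at least `1 - 6 e^{-u}`, where
`u ≥ D`, the whole process stays below a constant times `√(N u)` times the sum of the Lipschitz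
constant (scaled by `η`) and the bound at the centre.

The Euclidean norm of the gradient deviation and the operator norm of the Hessian deviation are
controlled by their values on a `1/2`-net of the unit ball with at most `5 ^ D` points
(`norm_le_of_net`, `opNorm_le_of_net`); taking `u = 8 R_N` absorbs the union bound because
`D ≤ R_N`. The definition of `R_N` makes all thresholds small multiples of `N c_min` or `N c_max`
(`chaining_threshold_le`). The remaining term `½ ∑ ε_i²`, which does not depend on `θ`, is handled
by the Chernoff bound `measure_sum_noise_sq_gt_le` and accounts for `e^{-N/8}`. The eigenvalue bound
then follows from the variational characterization of `lambdaMin`.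
-/

open MeasureTheory ProbabilityTheory

noncomputable section

namespace RandomDesign

open scoped NNReal RealInnerProductSpace

/-! ### Nets of the unit ball -/

section Nets

/-- The unit ball has a `1/2`-net with at most `5 ^ dim` points: a maximal `1`-separated subset of
the ball of radius `2`, halved. -/
theorem exists_half_net (V : Type*) [NormedAddCommGroup V] [NormedSpace ℝ V]
    [FiniteDimensional ℝ V] :
    ∃ S : Finset V, S.card ≤ 5 ^ Module.finrank ℝ V ∧ (∀ s ∈ S, ‖s‖ ≤ 1) ∧
      ∀ x : V, ‖x‖ ≤ 1 → ∃ s ∈ S, ‖x - s‖ ≤ 1 / 2 := by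
  classical
  let P : Finset V → Prop := fun s =>
    (∀ c ∈ s, ‖c‖ ≤ 2) ∧ ∀ c ∈ s, ∀ d ∈ s, c ≠ d → 1 ≤ ‖c - d‖
  have hbound : ∀ s, P s → s.card ≤ 5 ^ Module.finrank ℝ V :=
    fun s hs => Besicovitch.card_le_of_separated s hs.1 hs.2
  obtain ⟨T, hT, hmax⟩ : ∃ T, P T ∧ ∀ T', P T' → T'.card ≤ T.card := by
    have hne : {n | ∃ s, P s ∧ s.card = n}.Nonempty := ⟨0, ∅, by simp [P], rfl⟩
    have hbdd : BddAbove {n | ∃ s, P s ∧ s.card = n} := by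
      refine ⟨5 ^ Module.finrank ℝ V, ?_⟩
      rintro n ⟨s, hs, rfl⟩
      exact hbound s hs
    obtain ⟨T, hT, hc⟩ := Nat.sSup_mem hne hbdd
    refine ⟨T, hT, fun T' hT' => ?_⟩
    rw [hc]
    exact le_csSup hbdd ⟨T', hT', rfl⟩
  have hnet : ∀ x : V, ‖x‖ ≤ 2 → ∃ t ∈ T, ‖x - t‖ ≤ 1 := by
    intro x hx
    by_contra! hcon
    have hxT : x ∉ T := fun h => by simpa using (hcon x h).trans_le' (by simp : ‖x - x‖ ≤ 1)
    have hP : P (insert x T) := by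
      refine ⟨?_, ?_⟩
      · intro c hc
        rcases Finset.mem_insert.1 hc with rfl | hc
        · exact hx
        · exact hT.1 c hc
      · intro c hc d hd hcd
        rcases Finset.mem_insert.1 hc with hcx | hcT <;>
          rcases Finset.mem_insert.1 hd with hdx | hdT
        · exact absurd (hcx.trans hdx.symm) hcd
        · rw [hcx]; exact (hcon d hdT).le
        · rw [norm_sub_rev, hdx]; exact (hcon c hcT).le
        · exact hT.2 c hcT d hdT hcd
    have := hmax _ hP
    rw [Finset.card_insert_of_notMem hxT] at this
    omega
  refine ⟨T.image (fun t => (1 / 2 : ℝ) • t), Finset.card_image_le.trans (hbound T hT), ?_, ?_⟩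
  · intro s hs
    obtain ⟨t, ht, rfl⟩ := Finset.mem_image.1 hs
    have := hT.1 t ht
    rw [norm_smul]; norm_num; linarith
  · intro x hx
    obtain ⟨t, ht, hxt⟩ := hnet ((2 : ℝ) • x) (by rw [norm_smul]; norm_num; linarith)
    refine ⟨_, Finset.mem_image_of_mem _ ht, ?_⟩
    have : x - (1 / 2 : ℝ) • t = (1 / 2 : ℝ) • ((2 : ℝ) • x - t) := by
      rw [smul_sub, smul_smul]; norm_num
    rw [this, norm_smul]; norm_num; linarith

/-- Iterating the half-net gives `2⁻ʲ`-nets of the unit ball. Their points may leave the ball. -/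
theorem exists_dyadic_net (V : Type*) [NormedAddCommGroup V] [NormedSpace ℝ V]
    [FiniteDimensional ℝ V] (j : ℕ) :
    ∃ S : Finset V, S.card ≤ 5 ^ (Module.finrank ℝ V * j) ∧
      ∀ x : V, ‖x‖ ≤ 1 → ∃ s ∈ S, ‖x - s‖ ≤ (1 / 2) ^ j := by
  classical
  obtain ⟨S, hcard, -, hS⟩ := exists_half_net V
  induction j with
  | zero => exact ⟨{0}, by simp, fun x hx => ⟨0, by simp, by simpa using hx⟩⟩
  | succ j ih =>
    obtain ⟨T, hTcard, hT⟩ := ih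
    refine ⟨Finset.image₂ (fun t s => t + (1 / 2 : ℝ) ^ j • s) T S, ?_, ?_⟩
    · calc _ ≤ T.card * S.card := Finset.card_image₂_le _ _ _
        _ ≤ 5 ^ (Module.finrank ℝ V * j) * 5 ^ Module.finrank ℝ V := Nat.mul_le_mul hTcard hcard
        _ = _ := by rw [← pow_add]; ring_nf
    · intro x hx
      obtain ⟨t, ht, hxt⟩ := hT x hx
      have h2 : (0 : ℝ) < (1 / 2) ^ j := by positivity
      obtain ⟨s, hs, hs'⟩ := hS (((1 / 2 : ℝ) ^ j)⁻¹ • (x - t)) (by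
        rw [norm_smul, norm_inv, Real.norm_of_nonneg h2.le, inv_mul_le_iff₀ h2]; linarith)
      refine ⟨_, Finset.mem_image₂_of_mem ht hs, ?_⟩
      have : x - (t + (1 / 2 : ℝ) ^ j • s)
          = (1 / 2 : ℝ) ^ j • (((1 / 2 : ℝ) ^ j)⁻¹ • (x - t) - s) := by
        rw [smul_sub, smul_inv_smul₀ h2.ne']; abel
      rw [this, norm_smul, Real.norm_of_nonneg h2.le, pow_succ]
      exact mul_le_mul_of_nonneg_left hs' h2.le

/-- Dyadic nets contained in the open unit ball, where the process to be chained is defined; the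
price is a factor `2` in the radius. The coarsest net is the centre alone. -/
theorem exists_nets_in_ball (V : Type*) [NormedAddCommGroup V] [NormedSpace ℝ V]
    [FiniteDimensional ℝ V] :
    ∃ T : ℕ → Finset V, T 0 = {0} ∧ (∀ j, (T j).card ≤ 5 ^ (Module.finrank ℝ V * j)) ∧
      (∀ j, ∀ t ∈ T j, t ∈ Metric.ball (0 : V) 1) ∧
      ∀ j, ∀ x ∈ Metric.ball (0 : V) 1, ∃ t ∈ T j, ‖x - t‖ ≤ 2 * (1 / 2) ^ j := by
  classical
  have key : ∀ j : ℕ, ∃ T : Finset V, (j = 0 → T = {0}) ∧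
      T.card ≤ 5 ^ (Module.finrank ℝ V * j) ∧ (∀ t ∈ T, t ∈ Metric.ball (0 : V) 1) ∧
      ∀ x ∈ Metric.ball (0 : V) 1, ∃ t ∈ T, ‖x - t‖ ≤ 2 * (1 / 2) ^ j := by
    intro j
    rcases eq_or_ne j 0 with rfl | hj
    · refine ⟨{0}, fun _ => rfl, by simp, by simp, fun x hx => ⟨0, by simp, ?_⟩⟩
      have : ‖x‖ < 1 := by simpa using hx
      simp only [sub_zero, pow_zero]; linarith
    obtain ⟨S, hcard, hS⟩ := exists_dyadic_net V j
    -- move each centre whose ball meets the unit ball into the unit ball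
    have hf : ∀ s : V, ∃ t ∈ Metric.ball (0 : V) 1,
        ∀ x ∈ Metric.ball (0 : V) 1, ‖x - s‖ ≤ (1 / 2) ^ j → ‖x - t‖ ≤ 2 * (1 / 2) ^ j := by
      intro s
      by_cases h : ∃ t ∈ Metric.ball (0 : V) 1, ‖t - s‖ ≤ (1 / 2) ^ j
      · obtain ⟨t, ht, hts⟩ := h
        refine ⟨t, ht, fun x _ hxs => ?_⟩
        have := norm_sub_le_norm_sub_add_norm_sub x s t
        rw [norm_sub_rev s t] at this
        linarith
      · -- no point of the unit ball is close to `s`, so the value is irrelevant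
        push Not at h
        exact ⟨0, by simp, fun x hx hxs => absurd hxs (not_le.2 (h x hx))⟩
    choose f hf1 hf2 using hf
    refine ⟨S.image f, fun h => absurd h hj, Finset.card_image_le.trans hcard, ?_, ?_⟩
    · intro t ht
      obtain ⟨s, -, rfl⟩ := Finset.mem_image.1 ht
      exact hf1 s
    · intro x hx
      obtain ⟨s, hs, hxs⟩ := hS x (by simpa using (mem_ball_zero_iff.1 hx).le)
      exact ⟨f s, Finset.mem_image_of_mem f hs, hf2 s x hx hxs⟩
  choose T h0 h1 h2 h3 using key
  exact ⟨T, h0 0 rfl, h1, h2, h3⟩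

end Nets

/-! ### Dyadic chaining over the unit ball -/

section Chaining

theorem sum_succ_mul_half_pow_le (J : ℕ) :
    ∑ j ∈ Finset.range J, ((j : ℝ) + 1) * (1 / 2) ^ j ≤ 4 := by
  have h : ∑ j ∈ Finset.range J, ((j : ℝ) + 1) * (1 / 2) ^ j = 4 - (2 * J + 4) * (1 / 2) ^ J := by
    induction J with
    | zero => simp
    | succ J ih => rw [Finset.sum_range_succ, ih]; push_cast; ring
  rw [h]
  have : (0 : ℝ) ≤ (2 * J + 4) * (1 / 2) ^ J := by positivity
  linarith

variable {V : Type*} [NormedAddCommGroup V] [NormedSpace ℝ V] [FiniteDimensional ℝ V]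
  {Ω : Type*} [MeasurableSpace Ω]

theorem five_pow_le_exp (n : ℕ) : (5 : ℝ) ^ n ≤ Real.exp (2 * n) := by
  have h : (5 : ℝ) ≤ Real.exp 2 := by
    have h1 := Real.exp_one_gt_d9
    have : Real.exp 2 = Real.exp 1 * Real.exp 1 := by rw [← Real.exp_add]; norm_num
    rw [this]; nlinarith
  calc (5 : ℝ) ^ n ≤ Real.exp 2 ^ n := pow_le_pow_left₀ (by norm_num) h n
    _ = _ := by rw [← Real.exp_nat_mul]; ring_nf

/-- Chaining bound: if the increments of `X` over the unit ball have sub-Gaussian tails and the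
paths are continuous, then `|X p - X 0|` is at most `28 σ √u` for all `p` in the ball, outside an
event of measure `4 e^{-u}`, for every `u ≥ max 1 dim`. In the increment hypothesis `r` is only an
upper bound for the distance, so that nothing is required at distance zero. The
uncountable union over `p` need not be measurable; `μ` is its outer measure. -/
theorem measure_exists_ball_sub_gt_le (μ : Measure Ω) (X : V → Ω → ℝ) {σ u : ℝ} (hσ : 0 ≤ σ)
    (hu : 1 ≤ u) (hVu : (Module.finrank ℝ V : ℝ) ≤ u)
    (hX : ∀ p ∈ Metric.ball (0 : V) 1, ∀ q ∈ Metric.ball (0 : V) 1, ∀ r : ℝ, 0 < r → ‖p - q‖ ≤ r →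
      ∀ w : ℝ, 0 ≤ w →
        μ {ω | σ * r * √w < |X p ω - X q ω|} ≤ ENNReal.ofReal (2 * Real.exp (-w)))
    (hcont : ∀ ω, ContinuousOn (fun p => X p ω) (Metric.ball 0 1)) :
    μ {ω | ∃ p ∈ Metric.ball (0 : V) 1, 28 * σ * √u < |X p ω - X 0 ω|}
      ≤ ENNReal.ofReal (4 * Real.exp (-u)) := by
  classical
  obtain ⟨T, hT0, hTcard, hTball, hTnet⟩ := exists_nets_in_ball V
  -- `5 = 4 + 1`: a level has at most `e ^ (4 u (j + 1))` links, and `e ^ (-u (j + 1))` must remain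
  let w : ℕ → ℝ := fun j => 5 * u * (j + 1)
  let r : ℕ → ℝ := fun j => 3 * (1 / 2) ^ j
  -- the event that some link of the `j`-th level is long
  let bad : ℕ → Set Ω := fun j => ⋃ pq ∈ (T j ×ˢ T (j + 1)).filter (fun pq => ‖pq.2 - pq.1‖ ≤ r j),
    {ω | σ * r j * √(w j) < |X pq.2 ω - X pq.1 ω|}
  have hbad : ∀ j, μ (bad j) ≤ ENNReal.ofReal (2 * Real.exp (-u) * (1 / 2) ^ j) := by
    intro j
    have hw : 0 ≤ w j := by positivity
    calc μ (bad j) ≤ ∑ pq ∈ (T j ×ˢ T (j + 1)).filter (fun pq => ‖pq.2 - pq.1‖ ≤ r j),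
          μ {ω | σ * r j * √(w j) < |X pq.2 ω - X pq.1 ω|} := measure_biUnion_finset_le _ _
      _ ≤ ∑ pq ∈ (T j ×ˢ T (j + 1)).filter (fun pq => ‖pq.2 - pq.1‖ ≤ r j),
          ENNReal.ofReal (2 * Real.exp (-w j)) := by
          refine Finset.sum_le_sum fun pq hpq => ?_
          rw [Finset.mem_filter, Finset.mem_product] at hpq
          exact hX _ (hTball _ _ hpq.1.2) _ (hTball _ _ hpq.1.1) _ (by positivity) hpq.2 _ hw
      _ ≤ ENNReal.ofReal (2 * Real.exp (-u) * (1 / 2) ^ j) := by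
          rw [Finset.sum_const, nsmul_eq_mul, ← ENNReal.ofReal_natCast,
            ← ENNReal.ofReal_mul (by positivity)]
          apply ENNReal.ofReal_le_ofReal
          have hc : (((T j ×ˢ T (j + 1)).filter (fun pq => ‖pq.2 - pq.1‖ ≤ r j)).card : ℝ)
              ≤ Real.exp (4 * u * (j + 1)) := by
            have h1 : ((T j ×ˢ T (j + 1)).filter (fun pq => ‖pq.2 - pq.1‖ ≤ r j)).card
                ≤ 5 ^ (Module.finrank ℝ V * (2 * j + 1)) := by
              refine (Finset.card_filter_le _ _).trans ?_
              rw [Finset.card_product]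
              calc _ ≤ _ := Nat.mul_le_mul (hTcard j) (hTcard (j + 1))
                _ = _ := by rw [← pow_add]; ring_nf
            refine (Nat.cast_le.2 h1).trans ?_
            push_cast
            refine (five_pow_le_exp _).trans (Real.exp_le_exp.2 ?_)
            push_cast
            have hj : (0 : ℝ) ≤ j := by positivity
            nlinarith [mul_le_mul_of_nonneg_right hVu (by positivity : (0 : ℝ) ≤ 2 * j + 1)]
          have he : Real.exp (4 * u * (j + 1)) * Real.exp (-w j)
              ≤ Real.exp (-u) * (1 / 2) ^ j := by
            have h2 : Real.exp (-1) ≤ 1 / 2 := by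
              rw [Real.exp_neg, one_div]
              refine inv_anti₀ (by norm_num) ?_
              have := Real.exp_one_gt_d9; linarith
            calc _ = Real.exp (-u * (j + 1)) := by rw [← Real.exp_add]; congr 1; simp only [w]; ring
              _ ≤ Real.exp (-u + j * (-1)) := by
                apply Real.exp_le_exp.2
                have : (0 : ℝ) ≤ j := by positivity
                nlinarith
              _ = Real.exp (-u) * Real.exp (-1) ^ j := by rw [Real.exp_add, Real.exp_nat_mul]
              _ ≤ _ := by gcongr
          calc _ ≤ Real.exp (4 * u * (j + 1)) * (2 * Real.exp (-w j)) := by gcongr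
            _ = 2 * (Real.exp (4 * u * (j + 1)) * Real.exp (-w j)) := by ring
            _ ≤ 2 * (Real.exp (-u) * (1 / 2) ^ j) := by gcongr
            _ = _ := by ring
  -- telescope along the net points approaching `p`, then pass to the limit by continuity
  have hsub : {ω | ∃ p ∈ Metric.ball (0 : V) 1, 28 * σ * √u < |X p ω - X 0 ω|} ⊆ ⋃ j, bad j := by
    intro ω hω
    by_contra hgood
    obtain ⟨p, hp, hlt⟩ := hω
    have hlink : ∀ j, ∀ a ∈ T j, ∀ b ∈ T (j + 1), ‖b - a‖ ≤ r j →
        |X b ω - X a ω| ≤ σ * r j * √(w j) := by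
      intro j a ha b hb hab
      by_contra! hcon
      refine hgood (Set.mem_iUnion.2 ⟨j, Set.mem_iUnion₂.2 ⟨(a, b), ?_, hcon⟩⟩)
      exact Finset.mem_filter.2 ⟨Finset.mem_product.2 ⟨ha, hb⟩, hab⟩
    choose π hπT hπ using fun j => hTnet j p hp
    have hπ0 : π 0 = 0 := by simpa [hT0] using hπT 0
    have hsqrt : ∀ j : ℕ, σ * r j * √(w j) ≤ 7 * σ * √u * (((j : ℝ) + 1) * (1 / 2) ^ j) := by
      intro j
      have h1 : √(w j) ≤ (7 / 3) * √u * (j + 1) := by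
        apply Real.sqrt_le_iff.2 ⟨by positivity, ?_⟩
        rw [mul_pow, mul_pow, Real.sq_sqrt (by linarith)]
        have : (0 : ℝ) ≤ j := by positivity
        simp only [w]
        have hu0 : 0 ≤ u := by linarith
        nlinarith [mul_nonneg hu0 this, mul_nonneg (mul_nonneg hu0 this) this]
      calc σ * r j * √(w j) ≤ σ * r j * ((7 / 3) * √u * (j + 1)) := by gcongr
        _ = _ := by simp only [r]; ring
    have hstep : ∀ J, |X (π J) ω - X 0 ω| ≤ 28 * σ * √u := by
      intro J
      have htel : X (π J) ω - X 0 ω = ∑ j ∈ Finset.range J, (X (π (j + 1)) ω - X (π j) ω) := by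
        rw [Finset.sum_range_sub (fun j => X (π j) ω), hπ0]
      rw [htel]
      calc _ ≤ ∑ j ∈ Finset.range J, |X (π (j + 1)) ω - X (π j) ω| := Finset.abs_sum_le_sum_abs _ _
        _ ≤ ∑ j ∈ Finset.range J, 7 * σ * √u * (((j : ℝ) + 1) * (1 / 2) ^ j) := by
          refine Finset.sum_le_sum fun j _ => (hlink j _ (hπT j) _ (hπT (j + 1)) ?_).trans (hsqrt j)
          have h1 := hπ j
          have h2 := hπ (j + 1)
          have h3 := norm_sub_le_norm_sub_add_norm_sub (π (j + 1)) p (π j)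
          rw [norm_sub_rev (π (j + 1)) p] at h3
          rw [pow_succ] at h2
          simp only [r]; linarith
        _ ≤ 7 * σ * √u * 4 := by
          rw [← Finset.mul_sum]
          exact mul_le_mul_of_nonneg_left (sum_succ_mul_half_pow_le J) (by positivity)
        _ = _ := by ring
    have hlim : Filter.Tendsto π Filter.atTop (nhds p) := by
      have hgeo : Filter.Tendsto (fun j : ℕ => 2 * (1 / 2 : ℝ) ^ j) Filter.atTop (nhds 0) := by
        simpa using (tendsto_pow_atTop_nhds_zero_of_lt_one (by norm_num : (0 : ℝ) ≤ 1 / 2)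
          (by norm_num)).const_mul 2
      rw [tendsto_iff_norm_sub_tendsto_zero]
      exact squeeze_zero (fun _ => norm_nonneg _)
        (fun j => by rw [norm_sub_rev]; exact hπ j) hgeo
    have hXlim : Filter.Tendsto (fun J => |X (π J) ω - X 0 ω|) Filter.atTop
        (nhds |X p ω - X 0 ω|) := by
      have := ((hcont ω).continuousAt (Metric.isOpen_ball.mem_nhds hp)).tendsto.comp hlim
      exact (this.sub_const _).abs
    exact absurd (le_of_tendsto' hXlim hstep) (not_le.2 hlt)
  calc _ ≤ μ (⋃ j, bad j) := measure_mono hsub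
    _ ≤ ∑' j, μ (bad j) := measure_iUnion_le _
    _ ≤ ∑' j : ℕ, ENNReal.ofReal (2 * Real.exp (-u) * (1 / 2) ^ j) := ENNReal.tsum_le_tsum hbad
    _ = ENNReal.ofReal (4 * Real.exp (-u)) := by
      rw [← ENNReal.ofReal_tsum_of_nonneg (fun j => by positivity)
        (summable_geometric_two.mul_left _), tsum_mul_left, tsum_geometric_two]
      ring_nf

end Chaining

/-! ### Sub-Gaussian concentration for statistics affine in the noise -/

section Concentration

variable {d : ℕ} {O : Set (EuclideanSpace ℝ (Fin d))}

/-- The statistic `ε a(X) + b(X)` of an observation `z = (Y, X)`, where `ε = Y - g₀(X)` is the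
noise. -/
def noiseAffine (g0 : C(O, ℝ)) (a b : O → ℝ) (z : ℝ × O) : ℝ :=
  (z.1 - g0 z.2) * a z.2 + b z.2

/-- The centred sum `∑ (h(z_i) - E h(Z))`, with the expectation under the law of one observation. -/
def empDev (PX : Measure O) (g0 : C(O, ℝ)) {N : ℕ} (h : ℝ × O → ℝ) (z : Fin N → ℝ × O) : ℝ :=
  ∑ i, (h (z i) - ∫ w, h w ∂(obsLaw PX g0))

/-- A continuous linear functional of a vector-valued centred sum is a scalar centred sum. -/
theorem clm_sum_sub_integral {PX : Measure O} {g0 : C(O, ℝ)} {N : ℕ}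
    {W : Type*} [NormedAddCommGroup W] [NormedSpace ℝ W] [CompleteSpace W]
    (φ : W →L[ℝ] ℝ) {f : ℝ × O → W} (hf : Integrable f (obsLaw PX g0))
    (z : Fin N → ℝ × O) :
    φ (∑ i, f (z i) - (N : ℝ) • ∫ w, f w ∂(obsLaw PX g0))
      = empDev PX g0 (fun w => φ (f w)) z := by
  rw [empDev, Finset.sum_sub_distrib, Finset.sum_const, Finset.card_univ, Fintype.card_fin,
    φ.integral_comp_comm hf, map_sub, map_sum, map_smul, nsmul_eq_mul, smul_eq_mul]

theorem measurable_obsMap (g0 : C(O, ℝ)) :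
    Measurable (fun p : O × ℝ => (g0 p.1 + p.2, p.1)) := by
  have := g0.continuous.measurable
  fun_prop

instance isProbabilityMeasure_obsLaw (PX : Measure O) [IsProbabilityMeasure PX] (g0 : C(O, ℝ)) :
    IsProbabilityMeasure (obsLaw PX g0) :=
  Measure.isProbabilityMeasure_map (measurable_obsMap g0).aemeasurable

instance isProbabilityMeasure_dataLaw (PX : Measure O) [IsProbabilityMeasure PX] (g0 : C(O, ℝ))
    (N : ℕ) : IsProbabilityMeasure (dataLaw PX g0 N) := by
  unfold dataLaw; infer_instance

/-- Under `obsLaw`, the pair of design and noise has law `P^X ⊗ N(0,1)`. -/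
theorem measurePreserving_noise (PX : Measure O) [IsProbabilityMeasure PX] (g0 : C(O, ℝ)) :
    MeasurePreserving (fun z : ℝ × O => (z.2, z.1 - g0 z.2)) (obsLaw PX g0)
      (PX.prod (gaussianReal 0 1)) := by
  have hg := g0.continuous.measurable
  have hm : Measurable (fun z : ℝ × O => (z.2, z.1 - g0 z.2)) := by fun_prop
  refine ⟨hm, ?_⟩
  rw [obsLaw, Measure.map_map hm (measurable_obsMap g0)]
  convert Measure.map_id
  ext p <;> simp

variable {PX : Measure O} [IsProbabilityMeasure PX] {g0 : C(O, ℝ)}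

/-- Given `X = x` the variable `ε a(x)` is centred Gaussian with variance `a(x)² ≤ α²`. -/
theorem hasSubgaussianMGF_noise_mul {a : O → ℝ} (ha : Measurable a) {α : ℝ≥0}
    (hα : ∀ x, |a x| ≤ α) :
    HasSubgaussianMGF (fun z : ℝ × O => (z.1 - g0 z.2) * a z.2) (α ^ 2) (obsLaw PX g0) := by
  have hinner : ∀ t x, ∫ e, Real.exp (t * (e * a x)) ∂(gaussianReal 0 1)
      = Real.exp ((t * a x) ^ 2 / 2) := by
    intro t x
    have := congrFun (mgf_fun_id_gaussianReal (μ := 0) (v := 1)) (t * a x)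
    simp only [mgf, zero_mul, zero_add, NNReal.coe_one, one_mul] at this
    rw [← this]
    congr 1; ext e; ring_nf
  have hbound : ∀ t x, Real.exp ((t * a x) ^ 2 / 2) ≤ Real.exp ((α : ℝ) ^ 2 * t ^ 2 / 2) := by
    intro t x
    apply Real.exp_le_exp.2
    have : a x ^ 2 ≤ (α : ℝ) ^ 2 := sq_le_sq' (neg_le_of_abs_le (hα x)) (le_of_abs_le (hα x))
    nlinarith [sq_nonneg t, mul_le_mul_of_nonneg_left this (sq_nonneg t)]
  have hprod : HasSubgaussianMGF (fun p : O × ℝ => p.2 * a p.1) (α ^ 2)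
      (PX.prod (gaussianReal 0 1)) := by
    have hint : ∀ t, Integrable (fun p : O × ℝ => Real.exp (t * (p.2 * a p.1)))
        (PX.prod (gaussianReal 0 1)) := by
      intro t
      have hm : Measurable (fun p : O × ℝ => Real.exp (t * (p.2 * a p.1))) := by fun_prop
      rw [integrable_prod_iff hm.aestronglyMeasurable]
      refine ⟨ae_of_all _ fun x => ?_, ?_⟩
      · have := integrable_exp_mul_gaussianReal (μ := 0) (v := 1) (t * a x)
        refine this.congr (ae_of_all _ fun e => ?_)
        simp only; ring_nf
      · simp only [Real.norm_eq_abs, Real.abs_exp, hinner]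
        refine Integrable.of_bound (C := Real.exp ((α : ℝ) ^ 2 * t ^ 2 / 2)) ?_
          (ae_of_all _ fun x => ?_)
        · exact (by fun_prop : Measurable fun x => Real.exp ((t * a x) ^ 2 / 2)).aestronglyMeasurable
        · rw [Real.norm_of_nonneg (Real.exp_pos _).le]; exact hbound t x
    refine ⟨hint, fun t => ?_⟩
    rw [mgf, integral_prod _ (hint t)]
    simp only [hinner]
    calc _ ≤ ∫ _, Real.exp ((α : ℝ) ^ 2 * t ^ 2 / 2) ∂PX :=
          integral_mono_of_nonneg (ae_of_all _ fun x => (Real.exp_pos _).le) (integrable_const _)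
            (ae_of_all _ fun x => hbound t x)
      _ = _ := by simp
  have := (measurePreserving_noise PX g0).map_eq ▸ hprod
  exact HasSubgaussianMGF.of_map (measurePreserving_noise PX g0).measurable.aemeasurable this

theorem integral_noise_mul {a : O → ℝ} (ha : Measurable a) {α : ℝ} (hα : ∀ x, |a x| ≤ α) :
    ∫ z, (z.1 - g0 z.2) * a z.2 ∂(obsLaw PX g0) = 0 := by
  have hint : Integrable (fun p : O × ℝ => p.2 * a p.1) (PX.prod (gaussianReal 0 1)) := by
    have h1 : Integrable (fun e : ℝ => e) (gaussianReal 0 1) :=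
      (memLp_id_gaussianReal 1).integrable le_rfl
    have h2 : Integrable a PX := Integrable.of_bound ha.aestronglyMeasurable α (ae_of_all _ hα)
    exact (h2.mul_prod h1).congr (ae_of_all _ fun p => mul_comm _ _)
  have hm := measurePreserving_noise PX g0
  calc _ = ∫ p, p.2 * a p.1 ∂((obsLaw PX g0).map (fun z : ℝ × O => (z.2, z.1 - g0 z.2))) := by
        rw [integral_map hm.measurable.aemeasurable]
        exact (by fun_prop : Measurable fun p : O × ℝ => p.2 * a p.1).aestronglyMeasurable
    _ = 0 := by
      rw [hm.map_eq, integral_prod _ hint]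
      simp [integral_mul_const]

theorem integrable_noise_mul {a : O → ℝ} (ha : Measurable a) {α : ℝ} (hα : ∀ x, |a x| ≤ α) :
    Integrable (fun z : ℝ × O => (z.1 - g0 z.2) * a z.2) (obsLaw PX g0) :=
  (hasSubgaussianMGF_noise_mul ha (α := α.toNNReal)
    (fun x => (hα x).trans (Real.le_coe_toNNReal α))).integrable

theorem integrable_bounded_snd {b : O → ℝ} (hb : Measurable b) {β : ℝ} (hβ : ∀ x, |b x| ≤ β) :
    Integrable (fun z : ℝ × O => b z.2) (obsLaw PX g0) :=
  Integrable.of_bound (hb.comp measurable_snd).aestronglyMeasurable β (ae_of_all _ fun z => hβ z.2)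

theorem integrable_noiseAffine {a b : O → ℝ} (ha : Measurable a) (hb : Measurable b) {α : ℝ}
    (hα : ∀ x, |a x| ≤ α) (hβ : ∀ x, |b x| ≤ α) :
    Integrable (noiseAffine g0 a b) (obsLaw PX g0) :=
  (integrable_noise_mul ha hα).add (integrable_bounded_snd hb hβ)

theorem integral_noiseAffine {a b : O → ℝ} (ha : Measurable a) (hb : Measurable b) {α : ℝ}
    (hα : ∀ x, |a x| ≤ α) (hβ : ∀ x, |b x| ≤ α) :
    ∫ z, noiseAffine g0 a b z ∂(obsLaw PX g0) = ∫ z, b z.2 ∂(obsLaw PX g0) := by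
  unfold noiseAffine
  rw [integral_add (integrable_noise_mul ha hα) (integrable_bounded_snd hb hβ),
    integral_noise_mul ha hα, zero_add]

theorem hasSubgaussianMGF_noiseAffine {a b : O → ℝ} (ha : Measurable a) (hb : Measurable b)
    {α : ℝ≥0} (hα : ∀ x, |a x| ≤ α) (hβ : ∀ x, |b x| ≤ α) :
    HasSubgaussianMGF
      (fun z => noiseAffine g0 a b z - ∫ w, noiseAffine g0 a b w ∂(obsLaw PX g0))
      (4 * α ^ 2) (obsLaw PX g0) := by
  have h1 := hasSubgaussianMGF_noise_mul (PX := PX) (g0 := g0) ha hα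
  have h2 : HasSubgaussianMGF (fun z : ℝ × O => b z.2 - ∫ w, b w.2 ∂(obsLaw PX g0)) (α ^ 2)
      (obsLaw PX g0) := by
    have := hasSubgaussianMGF_of_mem_Icc (μ := obsLaw PX g0) (X := fun z : ℝ × O => b z.2)
      (a := -α) (b := α) (hb.comp measurable_snd).aemeasurable
      (ae_of_all _ fun z => abs_le.1 (hβ z.2))
    convert this using 2
    apply NNReal.eq
    simp only [sub_neg_eq_add, NNReal.coe_div, coe_nnnorm, NNReal.coe_ofNat]
    rw [Real.norm_of_nonneg (by positivity)]; ring
  have h3 := h1.add h2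
  rw [integral_noiseAffine ha hb hα hβ]
  convert h3 using 1
  · ext z; simp only [noiseAffine]; ring
  · rw [NNReal.sqrt_sq]; ring

theorem hasSubgaussianMGF_empDev {N : ℕ} {a b : O → ℝ} (ha : Measurable a) (hb : Measurable b)
    {α : ℝ≥0} (hα : ∀ x, |a x| ≤ α) (hβ : ∀ x, |b x| ≤ α) :
    HasSubgaussianMGF (empDev PX g0 (N := N) (noiseAffine g0 a b))
      (N * (4 * α ^ 2)) (dataLaw PX g0 N) := by
  have h1 := hasSubgaussianMGF_noiseAffine (PX := PX) (g0 := g0) ha hb hα hβ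
  have hind := iIndepFun_pi (μ := fun _ : Fin N => obsLaw PX g0) (X := fun _ z =>
    noiseAffine g0 a b z - ∫ w, noiseAffine g0 a b w ∂(obsLaw PX g0)) (fun _ => h1.aemeasurable)
  have := HasSubgaussianMGF.sum_of_iIndepFun hind (c := fun _ => 4 * α ^ 2) (s := Finset.univ)
    (fun i _ => by
      have h1' := h1
      generalize (∫ w, noiseAffine g0 a b w ∂(obsLaw PX g0)) = c at h1' ⊢
      have hp := measurePreserving_eval (fun _ : Fin N => obsLaw PX g0) i
      rw [← hp.map_eq] at h1'
      exact HasSubgaussianMGF.of_map hp.measurable.aemeasurable h1')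
  rwa [Finset.sum_const, Finset.card_univ, Fintype.card_fin, nsmul_eq_mul] at this

theorem measure_empDev_gt_le {N : ℕ} (hN : 1 ≤ N) {a b : O → ℝ} (ha : Measurable a)
    (hb : Measurable b) {α : ℝ} (hα0 : 0 < α) (hα : ∀ x, |a x| ≤ α) (hβ : ∀ x, |b x| ≤ α)
    {w : ℝ} (hw : 0 ≤ w) :
    dataLaw PX g0 N {z | 3 * α * √N * √w < |empDev PX g0 (noiseAffine g0 a b) z|}
      ≤ ENNReal.ofReal (2 * Real.exp (-w)) := by
  lift α to ℝ≥0 using hα0.le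
  have h := hasSubgaussianMGF_empDev (PX := PX) (g0 := g0) (N := N) ha hb hα hβ
  have hN' : (0 : ℝ) < N := by exact_mod_cast hN
  set s : ℝ := 3 * α * √N * √w
  have hs : 0 ≤ s := by positivity
  have hexp : Real.exp (-s ^ 2 / (2 * ((N * (4 * α ^ 2) : ℝ≥0) : ℝ))) ≤ Real.exp (-w) := by
    apply Real.exp_le_exp.2
    have : s ^ 2 = 9 * α ^ 2 * N * w := by
      simp only [s, mul_pow]; rw [Real.sq_sqrt hN'.le, Real.sq_sqrt hw]; ring
    push_cast
    rw [this, div_le_iff₀ (by positivity)]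
    have : 0 ≤ (α : ℝ) ^ 2 * N * w := by positivity
    nlinarith
  have h1 := (h.measure_ge_le hs).trans hexp
  have h2 := (h.neg.measure_ge_le hs).trans hexp
  calc _ ≤ dataLaw PX g0 N ({z | s ≤ empDev PX g0 (noiseAffine g0 a b) z} ∪
        {z | s ≤ (-empDev PX g0 (noiseAffine g0 a b)) z}) := by
        refine measure_mono fun z hz => ?_
        rcases lt_abs.1 (Set.mem_ofPred_eq ▸ hz) with h | h
        · exact Or.inl h.le
        · exact Or.inr h.le
    _ ≤ _ := measure_union_le _ _
    _ ≤ ENNReal.ofReal (Real.exp (-w)) + ENNReal.ofReal (Real.exp (-w)) := by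
      refine add_le_add ?_ ?_ <;> rw [← ofReal_measureReal] <;> apply ENNReal.ofReal_le_ofReal
      exacts [h1, h2]
    _ = _ := by rw [← ENNReal.ofReal_add (by positivity) (by positivity), two_mul]

/-- Uniform deviation bound over the unit ball: chaining controls the increments from the centre,
and the sub-Gaussian tail at the centre contributes the term with `κ`. -/
theorem measure_exists_ball_empDev_gt_le {V : Type*} [NormedAddCommGroup V] [NormedSpace ℝ V]
    [FiniteDimensional ℝ V] {N : ℕ} (hN : 1 ≤ N) {a b : V → O → ℝ}
    (ha : ∀ p ∈ Metric.ball (0 : V) 1, Measurable (a p))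
    (hb : ∀ p ∈ Metric.ball (0 : V) 1, Measurable (b p)) {κ L u : ℝ} (hκ : 0 < κ) (hL : 0 < L)
    (ha0 : ∀ x, |a 0 x| ≤ κ) (hb0 : ∀ x, |b 0 x| ≤ κ)
    (haL : ∀ p ∈ Metric.ball (0 : V) 1, ∀ q ∈ Metric.ball (0 : V) 1, ∀ x,
      |a p x - a q x| ≤ L * ‖p - q‖)
    (hbL : ∀ p ∈ Metric.ball (0 : V) 1, ∀ q ∈ Metric.ball (0 : V) 1, ∀ x,
      |b p x - b q x| ≤ L * ‖p - q‖)
    (hu : 1 ≤ u) (hVu : (Module.finrank ℝ V : ℝ) ≤ u) :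
    dataLaw PX g0 N {z | ∃ p ∈ Metric.ball (0 : V) 1,
        84 * (L + κ) * √N * √u < |empDev PX g0 (noiseAffine g0 (a p) (b p)) z|}
      ≤ ENNReal.ofReal (6 * Real.exp (-u)) := by
  have h0 : (0 : V) ∈ Metric.ball (0 : V) 1 := by simp
  have hbd : ∀ (f : V → O → ℝ), (∀ x, |f 0 x| ≤ κ) →
      (∀ p ∈ Metric.ball (0 : V) 1, ∀ q ∈ Metric.ball (0 : V) 1, ∀ x,
        |f p x - f q x| ≤ L * ‖p - q‖) →
      ∀ p ∈ Metric.ball (0 : V) 1, ∀ x, |f p x| ≤ κ + L := by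
    intro f hf0 hfL p hp x
    have h1 := hfL p hp 0 h0 x
    have h2 : ‖p - 0‖ ≤ 1 := by simpa using (mem_ball_zero_iff.1 hp).le
    have h3 := abs_sub_abs_le_abs_sub (f p x) (f 0 x)
    have h4 := hf0 x
    nlinarith
  have hab := hbd a ha0 haL
  have hbb := hbd b hb0 hbL
  have hdiff : ∀ p ∈ Metric.ball (0 : V) 1, ∀ q ∈ Metric.ball (0 : V) 1,
      ∀ z : Fin N → ℝ × O,
      empDev PX g0 (noiseAffine g0 (a p) (b p)) z - empDev PX g0 (noiseAffine g0 (a q) (b q)) z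
        = empDev PX g0 (noiseAffine g0 (fun x => a p x - a q x) (fun x => b p x - b q x)) z := by
    intro p hp q hq z
    have hfun : noiseAffine g0 (fun x => a p x - a q x) (fun x => b p x - b q x)
        = fun z => noiseAffine g0 (a p) (b p) z - noiseAffine g0 (a q) (b q) z := by
      ext z; simp only [noiseAffine]; ring
    simp only [empDev]
    rw [hfun, integral_sub
      (integrable_noiseAffine (ha p hp) (hb p hp) (hab p hp) (hbb p hp))
      (integrable_noiseAffine (ha q hq) (hb q hq) (hab q hq) (hbb q hq)),
      ← Finset.sum_sub_distrib]
    exact Finset.sum_congr rfl fun i _ => by ring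
  have hchain := measure_exists_ball_sub_gt_le (dataLaw PX g0 N)
    (fun (p : V) z => empDev PX g0 (noiseAffine g0 (a p) (b p)) z) (σ := 3 * L * √N)
    (by positivity) hu hVu
    (by
      intro p hp q hq r hr hpq w hw
      have hLr : L * ‖p - q‖ ≤ L * r := by gcongr
      have := measure_empDev_gt_le (PX := PX) (g0 := g0) hN (a := fun x => a p x - a q x)
        (b := fun x => b p x - b q x) ((ha p hp).sub (ha q hq)) ((hb p hp).sub (hb q hq))
        (α := L * r) (by positivity) (fun x => (haL p hp q hq x).trans hLr)
        (fun x => (hbL p hp q hq x).trans hLr) hw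
      refine le_trans (measure_mono fun z hz => ?_) this
      simp only [Set.mem_ofPred_eq, hdiff p hp q hq] at hz ⊢
      refine lt_of_eq_of_lt ?_ hz
      ring)
    (by
      intro z
      have hlip : ∀ p ∈ Metric.ball (0 : V) 1, ∀ q ∈ Metric.ball (0 : V) 1,
          dist (empDev PX g0 (noiseAffine g0 (a p) (b p)) z)
            (empDev PX g0 (noiseAffine g0 (a q) (b q)) z)
          ≤ (∑ i, (|(z i).1 - g0 (z i).2| * L + L + L)).toNNReal * dist p q := by
        intro p hp q hq
        rw [Real.dist_eq, hdiff p hp q hq, Real.coe_toNNReal _ (by positivity), Finset.sum_mul,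
          dist_eq_norm]
        refine (Finset.abs_sum_le_sum_abs _ _).trans (Finset.sum_le_sum fun i _ => ?_)
        rw [integral_noiseAffine (a := fun x => a p x - a q x) (b := fun x => b p x - b q x)
          (α := L * ‖p - q‖) ((ha p hp).sub (ha q hq)) ((hb p hp).sub (hb q hq))
          (haL p hp q hq) (hbL p hp q hq)]
        have hE : |∫ z : ℝ × O, (b p z.2 - b q z.2) ∂(obsLaw PX g0)| ≤ L * ‖p - q‖ := by
          have := norm_integral_le_of_norm_le_const (μ := obsLaw PX g0)
            (f := fun z : ℝ × O => b p z.2 - b q z.2) (C := L * ‖p - q‖)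
            (ae_of_all _ fun z => hbL p hp q hq z.2)
          simpa using this
        have h1 : |((z i).1 - g0 (z i).2) * (a p (z i).2 - a q (z i).2)|
            ≤ |(z i).1 - g0 (z i).2| * (L * ‖p - q‖) := by
          rw [abs_mul]
          exact mul_le_mul_of_nonneg_left (haL p hp q hq _) (abs_nonneg _)
        have h2 := hbL p hp q hq (z i).2
        simp only [noiseAffine]
        calc _ ≤ |((z i).1 - g0 (z i).2) * (a p (z i).2 - a q (z i).2)|
              + |b p (z i).2 - b q (z i).2|
              + |∫ z : ℝ × O, (b p z.2 - b q z.2) ∂(obsLaw PX g0)| :=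
              (abs_sub _ _).trans (add_le_add_left (abs_add_le _ _) _)
          _ ≤ |(z i).1 - g0 (z i).2| * (L * ‖p - q‖) + L * ‖p - q‖ + L * ‖p - q‖ := by gcongr
          _ = _ := by ring
      exact (LipschitzOnWith.of_dist_le_mul hlip).continuousOn)
  have hpt := measure_empDev_gt_le (PX := PX) (g0 := g0) hN (ha 0 h0) (hb 0 h0) hκ ha0 hb0
    (by linarith : (0 : ℝ) ≤ u)
  refine le_trans (measure_mono (fun z hz => ?_)) ((measure_union_le _ _).trans
    ((add_le_add hchain hpt).trans_eq ?_))
  · obtain ⟨p, hp, hz⟩ := hz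
    by_contra hcon
    rw [Set.mem_union, not_or] at hcon
    obtain ⟨hc1, hc2⟩ := hcon
    simp only [Set.mem_ofPred_eq, not_exists, not_and, not_lt] at hc1 hc2
    have h1 := hc1 p hp
    have h3 := abs_sub_abs_le_abs_sub (empDev PX g0 (noiseAffine g0 (a p) (b p)) z)
      (empDev PX g0 (noiseAffine g0 (a 0) (b 0)) z)
    have h4 : 0 ≤ κ * √N * √u := by positivity
    nlinarith
  · rw [← ENNReal.ofReal_add (by positivity) (by positivity)]
    ring_nf

end Concentration

/-! ### The sum of squared noise variables -/

section ChiSquare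

theorem integral_exp_quarter_sq_gaussianReal :
    ∫ e, Real.exp (1 / 4 * e ^ 2) ∂(gaussianReal 0 1) = √2 := by
  rw [integral_gaussianReal_eq_integral_smul one_ne_zero]
  have h : ∀ e : ℝ, gaussianPDFReal 0 1 e • Real.exp (1 / 4 * e ^ 2)
      = (√(2 * Real.pi))⁻¹ * Real.exp (-(1 / 4) * e ^ 2) := by
    intro e
    rw [gaussianPDFReal_def]
    simp only [NNReal.coe_one, mul_one, sub_zero, smul_eq_mul]
    rw [mul_assoc, ← Real.exp_add]
    ring_nf
  simp only [h]
  rw [integral_const_mul, integral_gaussian, ← Real.sqrt_inv, ← Real.sqrt_mul (by positivity)]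
  congr 1
  field_simp
  norm_num

variable {d : ℕ} {O : Set (EuclideanSpace ℝ (Fin d))}
  {PX : Measure O} [IsProbabilityMeasure PX] {g0 : C(O, ℝ)}

theorem integrable_noise_sq : Integrable (fun z : ℝ × O => (z.1 - g0 z.2) ^ 2) (obsLaw PX g0) := by
  have hm : MeasurePreserving (fun z : ℝ × O => z.1 - g0 z.2) (obsLaw PX g0) (gaussianReal 0 1) :=
    measurePreserving_snd.comp (measurePreserving_noise PX g0)
  have h1 : Integrable (fun e : ℝ => e ^ 2) (gaussianReal 0 1) :=
    (memLp_id_gaussianReal 2).integrable_sq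
  exact hm.integrable_comp_of_integrable h1

theorem integral_noise_sq : ∫ z, (z.1 - g0 z.2) ^ 2 ∂(obsLaw PX g0) = 1 := by
  have hm : MeasurePreserving (fun z : ℝ × O => z.1 - g0 z.2) (obsLaw PX g0) (gaussianReal 0 1) :=
    measurePreserving_snd.comp (measurePreserving_noise PX g0)
  have h1 : ∫ e, e ^ 2 ∂(gaussianReal 0 1) = 1 := by
    have h := variance_fun_id_gaussianReal (μ := 0) (v := 1)
    rw [variance_of_integral_eq_zero (by fun_prop) (by simp)] at h
    simpa using h
  rw [← h1, ← hm.map_eq, integral_map hm.measurable.aemeasurable (by fun_prop)]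

/-- Chernoff bound with parameter `1/4`: `E exp(ε²/4) = √2` and `√2 e^{-3/4} ≤ e^{-1/8}`. -/
theorem measure_sum_noise_sq_gt_le (N : ℕ) :
    dataLaw PX g0 N {z | 3 * N < ∑ i, ((z i).1 - g0 (z i).2) ^ 2}
      ≤ ENNReal.ofReal (Real.exp (-(N : ℝ) / 8)) := by
  have hm : MeasurePreserving (fun z : ℝ × O => z.1 - g0 z.2) (obsLaw PX g0) (gaussianReal 0 1) :=
    measurePreserving_snd.comp (measurePreserving_noise PX g0)
  have hsq : ∫ z, Real.exp (1 / 4 * (z.1 - g0 z.2) ^ 2) ∂(obsLaw PX g0) = √2 := by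
    rw [← integral_exp_quarter_sq_gaussianReal, ← hm.map_eq,
      integral_map hm.measurable.aemeasurable (by fun_prop)]
  have hmgf : ∫ z, Real.exp (1 / 4 * ∑ i, ((z i).1 - g0 (z i).2) ^ 2) ∂(dataLaw PX g0 N)
      = √2 ^ N := by
    have := integral_fintype_prod_eq_pow (ι := Fin N) (μ := obsLaw PX g0)
      (fun z : ℝ × O => Real.exp (1 / 4 * (z.1 - g0 z.2) ^ 2))
    rw [hsq, Fintype.card_fin] at this
    rw [← this, dataLaw]
    congr 1; ext z
    rw [Finset.mul_sum, Real.exp_sum]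
  -- the integral just computed is nonzero, so the integrand is integrable
  have hint : Integrable (fun z : Fin N → ℝ × O =>
      Real.exp (1 / 4 * ∑ i, ((z i).1 - g0 (z i).2) ^ 2)) (dataLaw PX g0 N) := by
    by_contra hcon
    rw [integral_undef hcon] at hmgf
    have : (0 : ℝ) < √2 ^ N := by positivity
    exact this.ne hmgf
  have hch := measure_ge_le_exp_mul_mgf (μ := dataLaw PX g0 N)
    (X := fun z : Fin N → ℝ × O => ∑ i, ((z i).1 - g0 (z i).2) ^ 2) (3 * N)
    (by norm_num : (0 : ℝ) ≤ 1 / 4) hint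
  rw [mgf, hmgf] at hch
  have hsqrt : √2 ≤ Real.exp (1 / 2) := by
    rw [Real.exp_half]
    apply Real.sqrt_le_sqrt
    have := Real.exp_one_gt_d9; linarith
  have hfin : Real.exp (-(1 / 4) * (3 * N)) * √2 ^ N ≤ Real.exp (-(N : ℝ) / 8) := by
    calc _ ≤ Real.exp (-(1 / 4) * (3 * N)) * Real.exp (1 / 2) ^ N := by gcongr
      _ = Real.exp (-(N : ℝ) / 4) := by
        rw [← Real.exp_nat_mul, ← Real.exp_add]; ring_nf
      _ ≤ _ := by
        apply Real.exp_le_exp.2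
        have : (0 : ℝ) ≤ N := by positivity
        linarith
  rw [← ofReal_measureReal]
  apply ENNReal.ofReal_le_ofReal
  refine le_trans (measureReal_mono fun z hz => ?_) (hch.trans hfin)
  rw [Set.mem_ofPred_eq] at hz ⊢
  exact hz.le

end ChiSquare

/-! ### Gradients and Hessians -/

section Calculus

variable {D : ℕ} {f : E D → ℝ} {θ : E D}

theorem gradient_eq_toDual_symm (f : E D → ℝ) :
    gradient f = (InnerProductSpace.toDual ℝ (E D)).symm ∘ fderiv ℝ f := rfl

theorem _root_.ContDiffAt.differentiableAt_gradient (hf : ContDiffAt ℝ 2 f θ) :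
    DifferentiableAt ℝ (gradient f) θ := by
  rw [gradient_eq_toDual_symm]
  have h1 : DifferentiableAt ℝ (fderiv ℝ f) θ :=
    (hf.fderiv_right (m := 1) (by norm_num)).differentiableAt (by norm_num)
  exact ((InnerProductSpace.toDual ℝ (E D)).symm.differentiableAt).comp θ h1

theorem hasFDerivAt_gradient (hf : ContDiffAt ℝ 2 f θ) :
    HasFDerivAt (gradient f) (hess f θ) θ :=
  hf.differentiableAt_gradient.hasFDerivAt

/-- The Hessian represents the second derivative through the inner product. -/
theorem inner_hess_left (hf : ContDiffAt ℝ 2 f θ) (v w : E D) :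
    ⟪hess f θ v, w⟫ = fderiv ℝ (fderiv ℝ f) θ v w := by
  have h1 : DifferentiableAt ℝ (fderiv ℝ f) θ :=
    (hf.fderiv_right (m := 1) (by norm_num)).differentiableAt (by norm_num)
  have h2 : HasFDerivAt (fun t => ⟪w, gradient f t⟫) ((innerSL ℝ w).comp (hess f θ)) θ :=
    (innerSL ℝ w).hasFDerivAt.comp θ (hasFDerivAt_gradient hf)
  have h3 : HasFDerivAt (fun t => fderiv ℝ f t w)
      ((ContinuousLinearMap.apply ℝ ℝ w).comp (fderiv ℝ (fderiv ℝ f) θ)) θ :=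
    (ContinuousLinearMap.apply ℝ ℝ w).hasFDerivAt.comp θ h1.hasFDerivAt
  have heq : (fun t => ⟪w, gradient f t⟫) = fun t => fderiv ℝ f t w := by
    ext t; rw [real_inner_comm, inner_gradient_left]
  rw [heq] at h2
  have := congrArg (fun T : E D →L[ℝ] ℝ => T v) (h2.unique h3)
  rw [real_inner_comm]
  simpa using this

theorem hess_symm (hf : ContDiffAt ℝ 2 f θ) (v w : E D) :
    ⟪hess f θ v, w⟫ = ⟪v, hess f θ w⟫ := by
  rw [real_inner_comm (hess f θ w) v, inner_hess_left hf, inner_hess_left hf]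
  exact hf.isSymmSndFDerivAt (by simp) v w

theorem hasGradientAt_neg_half_sq (hf : DifferentiableAt ℝ f θ) (y : ℝ) :
    HasGradientAt (fun t => -(1 / 2) * (y - f t) ^ 2) ((y - f θ) • gradient f θ) θ := by
  rw [hasGradientAt_iff_hasFDerivAt]
  have h := ((hf.hasFDerivAt.const_sub y).pow 2).const_mul (-(1 / 2))
  refine h.congr_fderiv ?_
  ext v
  simp [gradient]
  ring

theorem hess_neg_half_sq (hf : ContDiffAt ℝ 2 f θ) (y : ℝ) :
    hess (fun t => -(1 / 2) * (y - f t) ^ 2) θ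
      = (y - f θ) • hess f θ - (innerSL ℝ (gradient f θ)).smulRight (gradient f θ) := by
  have hev : gradient (fun t => -(1 / 2) * (y - f t) ^ 2)
      =ᶠ[nhds θ] fun t => (y - f t) • gradient f t := by
    filter_upwards [hf.eventually (by simp)] with t ht
    exact (hasGradientAt_neg_half_sq (ht.differentiableAt (by simp)) y).gradient
  have hd := hf.differentiableAt (by simp)
  have h := (hd.hasFDerivAt.const_sub y).smul (hasFDerivAt_gradient hf)
  rw [hess, hev.fderiv_eq]
  refine h.fderiv.trans ?_
  ext1 v
  simp [gradient, InnerProductSpace.toDual_symm_apply, sub_eq_add_neg]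

theorem gradient_fun_sum {ι : Type*} (s : Finset ι) {g : ι → E D → ℝ}
    (hg : ∀ i ∈ s, DifferentiableAt ℝ (g i) θ) :
    gradient (fun t => ∑ i ∈ s, g i t) θ = ∑ i ∈ s, gradient (g i) θ := by
  simp only [gradient]
  rw [fderiv_fun_sum hg, map_sum]

theorem hess_fun_sum {ι : Type*} (s : Finset ι) {g : ι → E D → ℝ}
    (hg : ∀ i ∈ s, ContDiffAt ℝ 2 (g i) θ) :
    hess (fun t => ∑ i ∈ s, g i t) θ = ∑ i ∈ s, hess (g i) θ := by
  have hev : gradient (fun t => ∑ i ∈ s, g i t)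
      =ᶠ[nhds θ] fun t => ∑ i ∈ s, gradient (g i) t := by
    have : ∀ᶠ t in nhds θ, ∀ i ∈ s, ContDiffAt ℝ 2 (g i) t :=
      (Filter.eventually_all_finset s).2 fun i hi => (hg i hi).eventually (by simp)
    filter_upwards [this] with t ht
    exact gradient_fun_sum s fun i hi => (ht i hi).differentiableAt (by simp)
  rw [hess, hev.fderiv_eq, fderiv_fun_sum fun i hi => (hg i hi).differentiableAt_gradient]
  rfl

end Calculus

/-! ### Measurability of derivatives in a parameter -/

section Measurability

/-- A linear map on `ℝ^D` is the sum of its columns. -/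
theorem clm_eq_sum {D : ℕ} {W : Type*} [NormedAddCommGroup W] [NormedSpace ℝ W]
    (A : E D →L[ℝ] W) :
    A = ∑ i, (EuclideanSpace.proj (𝕜 := ℝ) i).smulRight (A (EuclideanSpace.single i 1)) := by
  ext v
  have hv : v = ∑ i, v i • EuclideanSpace.single i (1 : ℝ) := by
    simpa using ((EuclideanSpace.basisFun (Fin D) ℝ).sum_repr v).symm
  conv_lhs => rw [hv, map_sum]
  simp

variable {D : ℕ} {X W : Type*} [MeasurableSpace X] [NormedAddCommGroup W] [NormedSpace ℝ W]
  [MeasurableSpace W] [BorelSpace W] [SecondCountableTopology W]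

/-- A directional derivative is a pointwise limit of difference quotients, hence measurable in the
parameter; no joint regularity in the point and the parameter is required. -/
theorem measurable_fderiv_param_apply {H : E D → X → W} {U : Set (E D)} (hU : IsOpen U)
    (hH : ∀ t ∈ U, Measurable (H t)) {θ : E D} (hθ : θ ∈ U)
    (hd : ∀ x, DifferentiableAt ℝ (fun t => H t x) θ) (v : E D) :
    Measurable (fun x => fderiv ℝ (fun t => H t x) θ v) := by
  have hlim : Filter.Tendsto (fun n : ℕ => θ + ((n : ℝ) + 1)⁻¹ • v) Filter.atTop (nhds θ) := by
    have : Filter.Tendsto (fun n : ℕ => ((n : ℝ) + 1)⁻¹) Filter.atTop (nhds 0) := by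
      simpa using tendsto_one_div_add_atTop_nhds_zero_nat (𝕜 := ℝ)
    simpa using (this.smul_const v).const_add θ
  -- the difference quotients stay in `U`, where `H` is measurable, from the index `n0` on
  obtain ⟨n0, hn0⟩ := Filter.eventually_atTop.1 (hlim.eventually (hU.mem_nhds hθ))
  refine measurable_of_tendsto_metrizable
    (f := fun (n : ℕ) x => ((n + n0 : ℕ) + 1 : ℝ) •
      (H (θ + (((n + n0 : ℕ) : ℝ) + 1)⁻¹ • v) x - H θ x))
    (fun n => ((hH _ (hn0 (n + n0) (by omega))).sub (hH θ hθ)).const_smul _) ?_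
  rw [tendsto_pi_nhds]
  intro x
  have h1 : Filter.Tendsto (fun n : ℕ => ((n : ℝ) + 1)) Filter.atTop Filter.atTop :=
    Filter.tendsto_atTop_add_const_right _ _ tendsto_natCast_atTop_atTop
  have h2 := (hd x).hasFDerivAt.lim v (tendsto_norm_atTop_atTop.comp h1)
  exact h2.comp (Filter.tendsto_add_atTop_nat n0)

theorem stronglyMeasurable_clm_of_apply {L : X → E D →L[ℝ] W}
    (hL : ∀ v, Measurable fun x => L x v) : StronglyMeasurable L := by
  have : L = fun x => ∑ i, ContinuousLinearMap.smulRightL ℝ (E D) W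
      (EuclideanSpace.proj (𝕜 := ℝ) i) (L x (EuclideanSpace.single i 1)) := by
    ext1 x; exact clm_eq_sum (L x)
  rw [this]
  refine Finset.stronglyMeasurable_fun_sum _ fun i _ => ?_
  exact (ContinuousLinearMap.continuous _).comp_stronglyMeasurable (hL _).stronglyMeasurable

end Measurability

/-! ### The smallest eigenvalue -/

section Spectrum

variable {D : ℕ}

theorem lambdaMin_le_inner [NeZero D] {A : E D →L[ℝ] E D} (hA : ∀ v w, ⟪A v, w⟫ = ⟪v, A w⟫)
    {v : E D} (hv : ‖v‖ = 1) : lambdaMin A ≤ ⟪A v, v⟫ := by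
  have hsym : (A : E D →ₗ[ℝ] E D).IsSymmetric := fun v w => hA v w
  have hnorm : ∀ x : E D, |⟪A x, x⟫| ≤ ‖A‖ * ‖x‖ ^ 2 := fun x => by
    calc _ ≤ ‖A x‖ * ‖x‖ := abs_real_inner_le_norm _ _
      _ ≤ ‖A‖ * ‖x‖ * ‖x‖ := by gcongr; exact A.le_opNorm x
      _ = _ := by ring
  have heig := hsym.hasEigenvalue_iInf_of_finiteDimensional
  have hbdd : BddBelow {μ : ℝ | Module.End.HasEigenvalue (A : E D →ₗ[ℝ] E D) μ} := by
    refine ⟨-‖A‖, fun μ hμ => ?_⟩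
    obtain ⟨x, hx⟩ := Module.End.HasEigenvalue.exists_hasEigenvector hμ
    have h1 : A x = μ • x := hx.apply_eq_smul
    have h2 := A.le_opNorm x
    rw [h1, norm_smul] at h2
    have h3 := le_of_mul_le_mul_right h2 (norm_pos_iff.2 hx.2)
    exact neg_le_of_abs_le h3
  refine (csInf_le hbdd heig).trans ?_
  have hb2 : BddBelow (Set.range fun x : { x : E D // x ≠ 0 } =>
      RCLike.re ⟪(A : E D →ₗ[ℝ] E D) x, (x : E D)⟫ / ‖(x : E D)‖ ^ 2) := by
    refine ⟨-‖A‖, ?_⟩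
    rintro _ ⟨⟨x, hx⟩, rfl⟩
    have h0 : 0 < ‖x‖ ^ 2 := by have := norm_pos_iff.2 hx; positivity
    rw [le_div_iff₀ h0]
    have := neg_le_of_abs_le (hnorm x)
    simp only [ContinuousLinearMap.coe_coe, RCLike.re_to_real]
    linarith
  have hv0 : v ≠ 0 := by rintro rfl; simp at hv
  refine (ciInf_le hb2 ⟨v, hv0⟩).trans ?_
  simp [hv]

theorem le_lambdaMin [NeZero D] {A : E D →L[ℝ] E D} (hA : ∀ v w, ⟪A v, w⟫ = ⟪v, A w⟫) {c : ℝ}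
    (hc : ∀ v : E D, ‖v‖ = 1 → c ≤ ⟪A v, v⟫) : c ≤ lambdaMin A := by
  have hsym : (A : E D →ₗ[ℝ] E D).IsSymmetric := fun v w => hA v w
  refine le_csInf ⟨_, hsym.hasEigenvalue_iInf_of_finiteDimensional⟩ fun μ hμ => ?_
  obtain ⟨x, hx⟩ := Module.End.HasEigenvalue.exists_hasEigenvector hμ
  have h1 : A x = μ • x := hx.apply_eq_smul
  have h0 : ‖x‖ ≠ 0 := norm_ne_zero_iff.2 hx.2
  have h2 := hc (‖x‖⁻¹ • x) (by rw [norm_smul, norm_inv, norm_norm, inv_mul_cancel₀ h0])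
  rw [map_smul, h1, inner_smul_left, inner_smul_left, inner_smul_right,
    real_inner_self_eq_norm_sq] at h2
  simp only [conj_trivial] at h2
  refine h2.trans_eq ?_
  field_simp

end Spectrum

/-! ### Norms from nets -/

section NetNorm

variable {V : Type*} [NormedAddCommGroup V] [InnerProductSpace ℝ V]

theorem norm_le_of_net {S : Finset V} (hS : ∀ x : V, ‖x‖ ≤ 1 → ∃ s ∈ S, ‖x - s‖ ≤ 1 / 2)
    {x : V} {m : ℝ} (hm : ∀ s ∈ S, |⟪x, s⟫| ≤ m) : ‖x‖ ≤ 2 * m := by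
  rcases eq_or_ne x 0 with rfl | hx
  · obtain ⟨s, hs, -⟩ := hS 0 (by simp)
    have := (abs_nonneg _).trans (hm s hs)
    simpa using this
  have h0 : ‖x‖ ≠ 0 := norm_ne_zero_iff.2 hx
  obtain ⟨s, hs, hxs⟩ := hS (‖x‖⁻¹ • x) (by rw [norm_smul, norm_inv, norm_norm, inv_mul_cancel₀ h0])
  have h1 : ‖x‖ = ⟪x, s⟫ + ⟪x, ‖x‖⁻¹ • x - s⟫ := by
    rw [← inner_add_right, add_sub_cancel, inner_smul_right, real_inner_self_eq_norm_sq]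
    field_simp
  have h2 : ⟪x, ‖x‖⁻¹ • x - s⟫ ≤ ‖x‖ * (1 / 2) :=
    (real_inner_le_norm _ _).trans (by gcongr)
  have h3 := le_of_abs_le (hm s hs)
  linarith

theorem opNorm_le_of_net {S : Finset V} (hS : ∀ x : V, ‖x‖ ≤ 1 → ∃ s ∈ S, ‖x - s‖ ≤ 1 / 2)
    {A : V →L[ℝ] V} {m : ℝ} (hm : ∀ s ∈ S, ∀ t ∈ S, |⟪A s, t⟫| ≤ m) : ‖A‖ ≤ 4 * m := by
  have h1 : ∀ s ∈ S, ‖A s‖ ≤ 2 * m := fun s hs => norm_le_of_net hS (hm s hs)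
  have hm0 : 0 ≤ 2 * m := by
    obtain ⟨s, hs, -⟩ := hS 0 (by simp)
    exact (norm_nonneg _).trans (h1 s hs)
  have h2 : ‖A‖ ≤ 2 * m + ‖A‖ / 2 := by
    refine A.opNorm_le_of_unit_norm (by positivity) fun x hx => ?_
    obtain ⟨s, hs, hxs⟩ := hS x hx.le
    calc ‖A x‖ = ‖A s + A (x - s)‖ := by rw [← map_add, add_sub_cancel]
      _ ≤ ‖A s‖ + ‖A (x - s)‖ := norm_add_le _ _
      _ ≤ 2 * m + ‖A‖ * (1 / 2) := by
        gcongr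
        · exact h1 s hs
        · exact (A.le_opNorm _).trans (by gcongr)
      _ = _ := by ring
  linarith

end NetNorm

/-! ### Ellipsoidal norms -/

section Ellipsoid

open scoped MatrixOrder Matrix.Norms.L2Operator

variable {D : ℕ} {M : Matrix (Fin D) (Fin D) ℝ}

theorem continuous_ellNorm (M : Matrix (Fin D) (Fin D) ℝ) : Continuous (ellNorm M) := by
  unfold ellNorm dotProduct Matrix.mulVec dotProduct
  fun_prop

theorem isOpen_ellBall (M : Matrix (Fin D) (Fin D) ℝ) (θs : E D) (η : ℝ) :
    IsOpen (ellBall M θs η) := by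
  have : Continuous fun θ => ellNorm M (θ - θs) := (continuous_ellNorm M).comp (by fun_prop)
  exact isOpen_lt this continuous_const

/-- The ellipsoidal norm is the Euclidean norm after a linear change of variables, `M = Bᵀ B`. -/
theorem exists_linearEquiv_ellNorm (hM : M.PosDef) :
    ∃ A : E D ≃ₗ[ℝ] E D, ∀ θ, ellNorm M θ = ‖A θ‖ := by
  obtain ⟨B, hB⟩ := CStarAlgebra.nonneg_iff_eq_star_mul_self.mp hM.posSemidef.nonneg
  let T : E D →ₗ[ℝ] E D := Matrix.toEuclideanLin B
  have hT : ∀ θ, ellNorm M θ = ‖T θ‖ := by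
    intro θ
    rw [ellNorm, hB, EuclideanSpace.norm_eq]
    congr 1
    rw [← Matrix.mulVec_mulVec, Matrix.star_eq_conjTranspose,
      Matrix.conjTranspose_eq_transpose_of_trivial, Matrix.dotProduct_mulVec,
      Matrix.vecMul_transpose]
    simp [T, dotProduct, sq]
  have hinj : Function.Injective T := by
    rw [← LinearMap.ker_eq_bot, LinearMap.ker_eq_bot']
    intro θ hθ
    by_contra hne
    have h1 := hM.dotProduct_mulVec_pos (x := θ.ofLp) (by simpa using hne)
    have h2 := hT θ
    rw [hθ, norm_zero, ellNorm, Real.sqrt_eq_zero'] at h2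
    rw [star_trivial] at h1
    exact absurd h1 (not_lt.2 h2)
  exact ⟨LinearEquiv.ofInjectiveEndo T hinj, hT⟩

end Ellipsoid

/-! ### Derivatives of the log-likelihood and their centred sums -/

section Model

variable {d D N : ℕ} {O : Set (EuclideanSpace ℝ (Fin d))} {PX : Measure O}
  [IsProbabilityMeasure PX] {g0 : C(O, ℝ)} {F : E D → C(O, ℝ)}
  {M : Matrix (Fin D) (Fin D) ℝ} {θs : E D} {η k0 k1 k2 m0 m1 m2 : ℝ} {θ : E D}

/-- Uniform deviation bound over the ellipsoid, transported from the unit ball. -/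
theorem measure_exists_ellBall_empDev_gt_le (hM : M.PosDef) (hη : 0 < η) (hN : 1 ≤ N)
    {a b : E D → O → ℝ}
    (ha : ∀ θ ∈ ellBall M θs η, Measurable (a θ)) (hb : ∀ θ ∈ ellBall M θs η, Measurable (b θ))
    {κ m u : ℝ} (hκ : 0 < κ) (hm : 0 < m)
    (ha0 : ∀ x, |a θs x| ≤ κ) (hb0 : ∀ x, |b θs x| ≤ κ)
    (haL : ∀ θ ∈ ellBall M θs η, ∀ θ' ∈ ellBall M θs η, ∀ x,
      |a θ x - a θ' x| ≤ m * ellNorm M (θ - θ'))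
    (hbL : ∀ θ ∈ ellBall M θs η, ∀ θ' ∈ ellBall M θs η, ∀ x,
      |b θ x - b θ' x| ≤ m * ellNorm M (θ - θ'))
    (hu : 1 ≤ u) (hDu : (D : ℝ) ≤ u) :
    dataLaw PX g0 N {z | ∃ θ ∈ ellBall M θs η,
        84 * (m * η + κ) * √N * √u < |empDev PX g0 (noiseAffine g0 (a θ) (b θ)) z|}
      ≤ ENNReal.ofReal (6 * Real.exp (-u)) := by
  obtain ⟨A, hA⟩ := exists_linearEquiv_ellNorm hM
  let φ : E D → E D := fun p => θs + η • A.symm p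
  have hdist : ∀ p q, ellNorm M (φ p - φ q) = η * ‖p - q‖ := by
    intro p q
    have : φ p - φ q = η • A.symm (p - q) := by simp only [φ, map_sub, smul_sub]; abel
    rw [this, hA, map_smul, A.apply_symm_apply, norm_smul, Real.norm_of_nonneg hη.le]
  have hφ0 : φ 0 = θs := by simp [φ]
  have hmem : ∀ p, φ p ∈ ellBall M θs η ↔ p ∈ Metric.ball (0 : E D) 1 := by
    intro p
    have h := hdist p 0
    rw [hφ0, sub_zero] at h
    rw [ellBall, Set.mem_ofPred_eq, h, mem_ball_zero_iff]
    constructor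
    · intro h1; by_contra! h2; nlinarith
    · intro h1; nlinarith
  have hsurj : ∀ θ, φ (η⁻¹ • A (θ - θs)) = θ := by
    intro θ
    simp only [φ, map_smul, A.symm_apply_apply, smul_inv_smul₀ hη.ne']
    abel
  have h := measure_exists_ball_empDev_gt_le (PX := PX) (g0 := g0) (V := E D) hN
    (a := fun p => a (φ p)) (b := fun p => b (φ p)) (fun p hp => ha _ ((hmem p).2 hp))
    (fun p hp => hb _ ((hmem p).2 hp)) hκ (L := m * η) (by positivity)
    (fun x => by simpa [hφ0] using ha0 x) (fun x => by simpa [hφ0] using hb0 x)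
    (fun p hp q hq x => by
      have := haL _ ((hmem p).2 hp) _ ((hmem q).2 hq) x
      rwa [hdist, ← mul_assoc] at this)
    (fun p hp q hq x => by
      have := hbL _ ((hmem p).2 hp) _ ((hmem q).2 hq) x
      rwa [hdist, ← mul_assoc] at this) hu (by simpa using hDu)
  refine le_trans (measure_mono fun z hz => ?_) h
  rw [Set.mem_ofPred_eq] at hz ⊢
  obtain ⟨θ, hθ, hz⟩ := hz
  refine ⟨η⁻¹ • A (θ - θs), (hmem _).1 (by rwa [hsurj]), ?_⟩
  simpa only [hsurj] using hz

theorem center_mem_ellBall (M : Matrix (Fin D) (Fin D) ℝ) (θs : E D) (hη : 0 < η) :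
    θs ∈ ellBall M θs η := by
  simpa [ellBall, ellNorm] using hη

theorem contDiffAt_forward (hreg : LocalRegularity F g0 M θs η k0 k1 k2 m0 m1 m2)
    (hθ : θ ∈ ellBall M θs η) (x : O) : ContDiffAt ℝ 2 (fun t => F t x) θ :=
  (hreg.contDiffOn x).contDiffAt ((isOpen_ellBall M θs η).mem_nhds hθ)

theorem measurable_inner_gradF (hreg : LocalRegularity F g0 M θs η k0 k1 k2 m0 m1 m2)
    (hθ : θ ∈ ellBall M θs η) (v : E D) : Measurable fun x => ⟪gradF F θ x, v⟫ := by
  simp only [gradF, inner_gradient_left]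
  exact measurable_fderiv_param_apply (isOpen_ellBall M θs η)
    (fun t _ => (F t).continuous.measurable) hθ
    (fun x => (contDiffAt_forward hreg hθ x).differentiableAt (by simp)) v

theorem measurable_gradF (hreg : LocalRegularity F g0 M θs η k0 k1 k2 m0 m1 m2)
    (hθ : θ ∈ ellBall M θs η) : Measurable (gradF F θ) := by
  have : gradF F θ = fun x => ∑ i, ⟪gradF F θ x, EuclideanSpace.single i 1⟫ •
      EuclideanSpace.single i (1 : ℝ) := by
    ext1 x
    have h := (EuclideanSpace.basisFun (Fin D) ℝ).sum_repr (gradF F θ x)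
    conv_lhs => rw [← h]
    simp [EuclideanSpace.inner_single_right]
  rw [this]
  exact Finset.measurable_fun_sum _ fun i _ => (measurable_inner_gradF hreg hθ _).smul_const _

theorem measurable_hessF_apply (hreg : LocalRegularity F g0 M θs η k0 k1 k2 m0 m1 m2)
    (hθ : θ ∈ ellBall M θs η) (v : E D) : Measurable fun x => hessF F θ x v :=
  measurable_fderiv_param_apply (H := gradF F) (isOpen_ellBall M θs η)
    (fun _ ht => measurable_gradF hreg ht) hθ
    (fun x => (contDiffAt_forward hreg hθ x).differentiableAt_gradient) v

theorem gradient_logLik (hreg : LocalRegularity F g0 M θs η k0 k1 k2 m0 m1 m2)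
    (hθ : θ ∈ ellBall M θs η) (z : ℝ × O) :
    gradient (fun t => logLik F t z) θ = (z.1 - F θ z.2) • gradF F θ z.2 :=
  (hasGradientAt_neg_half_sq
    ((contDiffAt_forward hreg hθ z.2).differentiableAt (by simp)) z.1).gradient

theorem hess_logLik (hreg : LocalRegularity F g0 M θs η k0 k1 k2 m0 m1 m2)
    (hθ : θ ∈ ellBall M θs η) (z : ℝ × O) :
    hess (fun t => logLik F t z) θ = (z.1 - F θ z.2) • hessF F θ z.2
      - (innerSL ℝ (gradF F θ z.2)).smulRight (gradF F θ z.2) :=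
  hess_neg_half_sq (contDiffAt_forward hreg hθ z.2) z.1

theorem contDiffAt_logLik (hreg : LocalRegularity F g0 M θs η k0 k1 k2 m0 m1 m2)
    (hθ : θ ∈ ellBall M θs η) (z : ℝ × O) : ContDiffAt ℝ 2 (fun t => logLik F t z) θ :=
  contDiffAt_const.mul ((contDiffAt_const.sub (contDiffAt_forward hreg hθ z.2)).pow 2)

theorem logLikN_eq_sum (F : E D → C(O, ℝ)) (θ : E D) (z : Fin N → ℝ × O) :
    logLikN F θ z = ∑ i, logLik F θ (z i) := by
  simp only [logLikN, logLik, Finset.mul_sum]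

theorem contDiffAt_logLikN (hreg : LocalRegularity F g0 M θs η k0 k1 k2 m0 m1 m2)
    (hθ : θ ∈ ellBall M θs η) (z : Fin N → ℝ × O) :
    ContDiffAt ℝ 2 (fun t => logLikN F t z) θ := by
  simp only [logLikN_eq_sum]
  exact ContDiffAt.sum fun i _ => contDiffAt_logLik hreg hθ (z i)

theorem gradient_logLikN (hreg : LocalRegularity F g0 M θs η k0 k1 k2 m0 m1 m2)
    (hθ : θ ∈ ellBall M θs η) (z : Fin N → ℝ × O) :
    gradient (fun t => logLikN F t z) θ = ∑ i, gradient (fun t => logLik F t (z i)) θ := by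
  simp only [logLikN_eq_sum]
  exact gradient_fun_sum _ fun i _ => (contDiffAt_logLik hreg hθ (z i)).differentiableAt (by simp)

theorem hess_logLikN (hreg : LocalRegularity F g0 M θs η k0 k1 k2 m0 m1 m2)
    (hθ : θ ∈ ellBall M θs η) (z : Fin N → ℝ × O) :
    hess (fun t => logLikN F t z) θ = ∑ i, hess (fun t => logLik F t (z i)) θ := by
  simp only [logLikN_eq_sum]
  exact hess_fun_sum _ fun i _ => contDiffAt_logLik hreg hθ (z i)

/-- Functions of at most linear growth in the noise are integrable. -/
theorem integrable_of_norm_le_noise {W : Type*} [NormedAddCommGroup W] {f : ℝ × O → W}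
    (hf : StronglyMeasurable f) {α β : ℝ}
    (h : ∀ z, ‖f z‖ ≤ |z.1 - g0 z.2| * α + β) : Integrable f (obsLaw PX g0) := by
  have h1 : Integrable (fun z : ℝ × O => (z.1 - g0 z.2) * (1 : ℝ)) (obsLaw PX g0) :=
    integrable_noise_mul (a := fun _ => 1) (by fun_prop) (α := 1) (by simp)
  have h2 : Integrable (fun z : ℝ × O => |z.1 - g0 z.2| * α + β) (obsLaw PX g0) := by
    simp only [mul_one] at h1
    exact (h1.abs.mul_const α).add (integrable_const β)
  exact h2.mono' hf.aestronglyMeasurable (ae_of_all _ h)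

theorem abs_sub_forward_le (hreg : LocalRegularity F g0 M θs η k0 k1 k2 m0 m1 m2)
    (hθ : θ ∈ ellBall M θs η) (z : ℝ × O) : |z.1 - F θ z.2| ≤ |z.1 - g0 z.2| + k0 := by
  have h1 := hreg.bound0 θ hθ z.2
  have h2 : z.1 - F θ z.2 = (z.1 - g0 z.2) - (F θ z.2 - g0 z.2) := by ring
  rw [h2]
  exact (abs_sub _ _).trans (by gcongr)

theorem integrable_gradient_logLik (hreg : LocalRegularity F g0 M θs η k0 k1 k2 m0 m1 m2)
    (hθ : θ ∈ ellBall M θs η) :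
    Integrable (fun z => gradient (fun t => logLik F t z) θ) (obsLaw PX g0) := by
  have hF := (F θ).continuous.measurable
  have hG := measurable_gradF hreg hθ
  simp only [gradient_logLik hreg hθ]
  refine integrable_of_norm_le_noise (α := k1) (β := k0 * k1) ?_ fun z => ?_
  · exact Measurable.stronglyMeasurable (by fun_prop)
  · rw [norm_smul, Real.norm_eq_abs]
    have h0 := hreg.k0_pos
    have h1 := abs_sub_forward_le hreg hθ z
    have h2 := hreg.bound1 θ hθ z.2
    calc _ ≤ (|z.1 - g0 z.2| + k0) * k1 := by gcongr
      _ = _ := by ring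

theorem integrable_hess_logLik (hreg : LocalRegularity F g0 M θs η k0 k1 k2 m0 m1 m2)
    (hθ : θ ∈ ellBall M θs η) :
    Integrable (fun z => hess (fun t => logLik F t z) θ) (obsLaw PX g0) := by
  have hF := (F θ).continuous.measurable
  have hG := measurable_gradF hreg hθ
  simp only [hess_logLik hreg hθ]
  refine integrable_of_norm_le_noise (α := k2) (β := k0 * k2 + k1 * k1) ?_ fun z => ?_
  · refine stronglyMeasurable_clm_of_apply fun v => ?_
    have hH := measurable_hessF_apply hreg hθ v
    have hI : Measurable fun x => ⟪gradF F θ x, v⟫ := measurable_inner_gradF hreg hθ v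
    simp only [sub_apply, smul_apply,
      ContinuousLinearMap.smulRight_apply, innerSL_apply_apply]
    fun_prop
  · refine (norm_sub_le _ _).trans ?_
    rw [norm_smul, Real.norm_eq_abs, ContinuousLinearMap.norm_smulRight_apply, innerSL_apply_norm]
    have h0 := hreg.k0_pos
    have h1 := abs_sub_forward_le hreg hθ z
    have h2 := hreg.bound1 θ hθ z.2
    have h3 := hreg.bound2 θ hθ z.2
    have := hreg.k1_pos
    calc _ ≤ (|z.1 - g0 z.2| + k0) * k2 + k1 * k1 := by gcongr
      _ = _ := by ring

/-- The centred gradient of `ℓ_N`, tested against `v`, is the centred sum of a statistic affine in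
the noise. -/
theorem inner_gradient_dev (hreg : LocalRegularity F g0 M θs η k0 k1 k2 m0 m1 m2)
    (hθ : θ ∈ ellBall M θs η) (z : Fin N → ℝ × O) (v : E D) :
    ⟪gradient (fun t => logLikN F t z) θ
        - (N : ℝ) • ∫ w, gradient (fun t => logLik F t w) θ ∂(obsLaw PX g0), v⟫
      = empDev PX g0 (noiseAffine g0 (fun x => ⟪gradF F θ x, v⟫)
        (fun x => -((F θ x - g0 x) * ⟪gradF F θ x, v⟫))) z := by
  rw [gradient_logLikN hreg hθ, real_inner_comm]
  refine (clm_sum_sub_integral (innerSL ℝ v) (integrable_gradient_logLik hreg hθ) z).trans ?_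
  congr 1
  ext w
  rw [gradient_logLik hreg hθ, innerSL_apply_apply, inner_smul_right, real_inner_comm, noiseAffine]
  ring

/-- The centred Hessian of `ℓ_N`, tested against `v` and `w`, is the centred sum of a statistic
affine in the noise. -/
theorem inner_hess_dev (hreg : LocalRegularity F g0 M θs η k0 k1 k2 m0 m1 m2)
    (hθ : θ ∈ ellBall M θs η) (z : Fin N → ℝ × O) (v w : E D) :
    ⟪(hess (fun t => logLikN F t z) θ
        - (N : ℝ) • ∫ w, hess (fun t => logLik F t w) θ ∂(obsLaw PX g0)) v, w⟫
      = empDev PX g0 (noiseAffine g0 (fun x => ⟪hessF F θ x v, w⟫)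
        (fun x => -((F θ x - g0 x) * ⟪hessF F θ x v, w⟫
          + ⟪gradF F θ x, v⟫ * ⟪gradF F θ x, w⟫))) z := by
  rw [hess_logLikN hreg hθ, real_inner_comm]
  refine (clm_sum_sub_integral ((innerSL ℝ w).comp (ContinuousLinearMap.apply ℝ (E D) v))
    (integrable_hess_logLik hreg hθ) z).trans ?_
  congr 1
  ext y
  rw [hess_logLik hreg hθ, noiseAffine]
  simp only [ContinuousLinearMap.comp_apply, ContinuousLinearMap.apply_apply,
    innerSL_apply_apply, sub_apply, smul_apply,
    ContinuousLinearMap.smulRight_apply, inner_sub_right, inner_smul_right]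
  rw [real_inner_comm w (hessF F θ y.2 v), real_inner_comm w (gradF F θ y.2)]
  ring

/-- The centred `ℓ_N` is the centred sum of a statistic affine in the noise, up to the term
`½ (∑ ε_i² - N)`, which does not depend on `θ`. -/
theorem logLikN_dev (hreg : LocalRegularity F g0 M θs η k0 k1 k2 m0 m1 m2)
    (hθ : θ ∈ ellBall M θs η) (z : Fin N → ℝ × O) :
    logLikN F θ z - N * ∫ w, logLik F θ w ∂(obsLaw PX g0)
      = empDev PX g0 (noiseAffine g0 (fun x => F θ x - g0 x)
          (fun x => -(1 / 2) * (F θ x - g0 x) ^ 2)) z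
        - 1 / 2 * (∑ i, ((z i).1 - g0 (z i).2) ^ 2 - N) := by
  have hF := (F θ).continuous.measurable
  have hg := g0.continuous.measurable
  have hlik : ∀ w, logLik F θ w = noiseAffine g0 (fun x => F θ x - g0 x)
      (fun x => -(1 / 2) * (F θ x - g0 x) ^ 2) w - 1 / 2 * (w.1 - g0 w.2) ^ 2 := by
    intro w; simp only [logLik, noiseAffine]; ring
  have hint : Integrable (noiseAffine g0 (fun x => F θ x - g0 x)
      (fun x => -(1 / 2) * (F θ x - g0 x) ^ 2)) (obsLaw PX g0) := by
    refine integrable_noiseAffine (α := k0 + k0 ^ 2) (by fun_prop) (by fun_prop)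
      (fun x => ?_) (fun x => ?_)
    · have := hreg.bound0 θ hθ x
      nlinarith [sq_nonneg k0]
    · have h := hreg.bound0 θ hθ x
      have hk := hreg.k0_pos
      rw [abs_mul, abs_pow]
      norm_num
      have : |F θ x - g0 x| ^ 2 ≤ k0 ^ 2 := by gcongr
      rw [sq_abs] at this
      nlinarith [sq_nonneg (F θ x - g0 x)]
  simp only [logLikN_eq_sum, hlik]
  rw [integral_sub hint (integrable_noise_sq.const_mul _), integral_const_mul, integral_noise_sq,
    empDev, Finset.sum_sub_distrib, Finset.sum_sub_distrib, ← Finset.mul_sum, Finset.sum_const,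
    Finset.card_univ, Fintype.card_fin, nsmul_eq_mul]
  ring

theorem integral_hess_symm (hreg : LocalRegularity F g0 M θs η k0 k1 k2 m0 m1 m2)
    (hθ : θ ∈ ellBall M θs η) (v w : E D) :
    ⟪(∫ z, hess (fun t => logLik F t z) θ ∂(obsLaw PX g0)) v, w⟫
      = ⟪v, (∫ z, hess (fun t => logLik F t z) θ ∂(obsLaw PX g0)) w⟫ := by
  have hi := integrable_hess_logLik (PX := PX) hreg hθ
  have h : ∀ v w, ⟪w, (∫ z, hess (fun t => logLik F t z) θ ∂(obsLaw PX g0)) v⟫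
      = ∫ z, ⟪w, hess (fun t => logLik F t z) θ v⟫ ∂(obsLaw PX g0) := fun v w =>
    (((innerSL ℝ w).comp (ContinuousLinearMap.apply ℝ (E D) v)).integral_comp_comm hi).symm
  rw [real_inner_comm, h, h]
  refine integral_congr_ae (ae_of_all _ fun z => ?_)
  simp only
  rw [real_inner_comm, hess_symm (contDiffAt_logLik hreg hθ z)]

end Model

/-! ### Uniform deviations of the log-likelihood and its derivatives -/

section Events

variable {d D N : ℕ} {O : Set (EuclideanSpace ℝ (Fin d))} {PX : Measure O}
  [IsProbabilityMeasure PX] {g0 : C(O, ℝ)} {F : E D → C(O, ℝ)}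
  {M : Matrix (Fin D) (Fin D) ℝ} {θs : E D} {η k0 k1 k2 m0 m1 m2 u : ℝ} {θ : E D}

theorem abs_mul_sub_mul_le {a b a' b' A B δ ε : ℝ} (ha : |a| ≤ A) (hb' : |b'| ≤ B)
    (hab : |a - a'| ≤ δ) (hbb : |b - b'| ≤ ε) : |a * b - a' * b'| ≤ A * ε + δ * B := by
  have h : a * b - a' * b' = a * (b - b') + (a - a') * b' := by ring
  rw [h]
  refine (abs_add_le _ _).trans ?_
  rw [abs_mul, abs_mul]
  have := (abs_nonneg a).trans ha
  have := (abs_nonneg _).trans hab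
  gcongr

theorem abs_inner_le_of_norm_le {V : Type*} [NormedAddCommGroup V] [InnerProductSpace ℝ V]
    {x v : V} (hv : ‖v‖ ≤ 1) {k : ℝ} (hx : ‖x‖ ≤ k) : |⟪x, v⟫| ≤ k :=
  calc _ ≤ ‖x‖ * ‖v‖ := abs_real_inner_le_norm _ _
    _ ≤ k * 1 := by have := (norm_nonneg x).trans hx; gcongr
    _ = k := mul_one k

theorem abs_inner_apply_le_of_norm_le {V : Type*} [NormedAddCommGroup V] [InnerProductSpace ℝ V]
    {A : V →L[ℝ] V} {v w : V} (hv : ‖v‖ ≤ 1) (hw : ‖w‖ ≤ 1) {k : ℝ} (hA : ‖A‖ ≤ k) :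
    |⟪A v, w⟫| ≤ k :=
  abs_inner_le_of_norm_le hw <| (A.le_opNorm v).trans <|
    (mul_le_of_le_one_right (norm_nonneg A) hv).trans hA

theorem measure_logLik_dev_gt_le (hM : M.PosDef) (hη : 0 < η) (hN : 1 ≤ N)
    (hreg : LocalRegularity F g0 M θs η k0 k1 k2 m0 m1 m2) (hu : 1 ≤ u) (hDu : (D : ℝ) ≤ u) :
    dataLaw PX g0 N {z | ∃ θ ∈ ellBall M θs η,
        84 * ((k0 * m0 + m0) * η + (k0 ^ 2 + k0)) * √N * √u
          < |empDev PX g0 (noiseAffine g0 (fun x => F θ x - g0 x)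
            (fun x => -(1 / 2) * (F θ x - g0 x) ^ 2)) z|}
      ≤ ENNReal.ofReal (6 * Real.exp (-u)) := by
  have hg := g0.continuous.measurable
  have hk0 := hreg.k0_pos
  have hm0 := hreg.m0_pos
  have hF : ∀ θ : E D, Measurable (F θ) := fun θ => (F θ).continuous.measurable
  have hc := center_mem_ellBall M θs hη
  refine measure_exists_ellBall_empDev_gt_le hM hη hN (a := fun θ x => F θ x - g0 x)
    (b := fun θ x => -(1 / 2) * (F θ x - g0 x) ^ 2) (fun θ _ => (hF θ).sub hg)
    (fun θ _ => (((hF θ).sub hg).pow_const 2).const_mul _) (by positivity) (by positivity)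
    (fun x => ?_) (fun x => ?_) (fun θ hθ θ' hθ' x => ?_) (fun θ hθ θ' hθ' x => ?_) hu hDu
  · have := hreg.bound0 θs hc x
    nlinarith
  · have h := hreg.bound0 θs hc x
    have h2 : |F θs x - g0 x| ^ 2 ≤ k0 ^ 2 := by gcongr
    rw [abs_mul, abs_pow]
    norm_num
    rw [sq_abs] at h2
    nlinarith [sq_nonneg (F θs x - g0 x)]
  · have h := hreg.lip0 θ hθ θ' hθ' x
    have h0 : 0 ≤ ellNorm M (θ - θ') := Real.sqrt_nonneg _
    rw [sub_sub_sub_cancel_right]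
    refine h.trans ?_
    have : 0 ≤ k0 * m0 := by positivity
    nlinarith [mul_nonneg this h0]
  · have h := hreg.lip0 θ hθ θ' hθ' x
    have h0 : 0 ≤ ellNorm M (θ - θ') := Real.sqrt_nonneg _
    have h1 : |(F θ x - g0 x) - (F θ' x - g0 x)| ≤ m0 * ellNorm M (θ - θ') := by
      rwa [sub_sub_sub_cancel_right]
    have h2 := abs_mul_sub_mul_le (hreg.bound0 θ hθ x) (hreg.bound0 θ' hθ' x) h1 h1
    have h3 : -(1 / 2) * (F θ x - g0 x) ^ 2 - -(1 / 2) * (F θ' x - g0 x) ^ 2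
        = -(1 / 2) * ((F θ x - g0 x) * (F θ x - g0 x) - (F θ' x - g0 x) * (F θ' x - g0 x)) := by
      ring
    rw [h3, abs_mul, abs_neg, abs_of_pos (by norm_num : (0 : ℝ) < 1 / 2)]
    have : 0 ≤ m0 * ellNorm M (θ - θ') := by positivity
    nlinarith

theorem measure_gradient_dev_gt_le (hM : M.PosDef) (hη : 0 < η) (hN : 1 ≤ N)
    (hreg : LocalRegularity F g0 M θs η k0 k1 k2 m0 m1 m2) (hu : 1 ≤ u) (hDu : (D : ℝ) ≤ u)
    {v : E D} (hv : ‖v‖ ≤ 1) :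
    dataLaw PX g0 N {z | ∃ θ ∈ ellBall M θs η,
        84 * ((m1 + k0 * m1 + k1 * m0) * η + (k1 + k0 * k1)) * √N * √u
          < |empDev PX g0 (noiseAffine g0 (fun x => ⟪gradF F θ x, v⟫)
        (fun x => -((F θ x - g0 x) * ⟪gradF F θ x, v⟫))) z|}
      ≤ ENNReal.ofReal (6 * Real.exp (-u)) := by
  have hg := g0.continuous.measurable
  have hk0 := hreg.k0_pos
  have hk1 := hreg.k1_pos
  have hm0 := hreg.m0_pos
  have hm1 := hreg.m1_pos
  have hF : ∀ θ : E D, Measurable (F θ) := fun θ => (F θ).continuous.measurable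
  have hc := center_mem_ellBall M θs hη
  have hb : ∀ θ ∈ ellBall M θs η, ∀ x, |⟪gradF F θ x, v⟫| ≤ k1 := fun θ hθ x =>
    abs_inner_le_of_norm_le hv (hreg.bound1 θ hθ x)
  have hl : ∀ θ ∈ ellBall M θs η, ∀ θ' ∈ ellBall M θs η, ∀ x,
      |⟪gradF F θ x, v⟫ - ⟪gradF F θ' x, v⟫| ≤ m1 * ellNorm M (θ - θ') := fun θ hθ θ' hθ' x => by
    rw [← inner_sub_left]
    exact abs_inner_le_of_norm_le hv (hreg.lip1 θ hθ θ' hθ' x)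
  refine measure_exists_ellBall_empDev_gt_le hM hη hN (a := fun θ x => ⟪gradF F θ x, v⟫)
    (b := fun θ x => -((F θ x - g0 x) * ⟪gradF F θ x, v⟫))
    (fun θ hθ => measurable_inner_gradF hreg hθ v)
    (fun θ hθ => (((hF θ).sub hg).mul (measurable_inner_gradF hreg hθ v)).neg)
    (by positivity) (by positivity)
    (fun x => ?_) (fun x => ?_) (fun θ hθ θ' hθ' x => ?_) (fun θ hθ θ' hθ' x => ?_) hu hDu
  · exact (hb θs hc x).trans (le_add_of_nonneg_right (by positivity))
  · rw [abs_neg, abs_mul]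
    have := mul_le_mul (hreg.bound0 θs hc x) (hb θs hc x) (abs_nonneg _) hk0.le
    linarith
  · have h0 : 0 ≤ ellNorm M (θ - θ') := Real.sqrt_nonneg _
    refine (hl θ hθ θ' hθ' x).trans (mul_le_mul_of_nonneg_right ?_ h0)
    have : 0 ≤ k0 * m1 + k1 * m0 := by positivity
    linarith
  · have h0 : 0 ≤ ellNorm M (θ - θ') := Real.sqrt_nonneg _
    have h1 : |(F θ x - g0 x) - (F θ' x - g0 x)| ≤ m0 * ellNorm M (θ - θ') := by
      rw [sub_sub_sub_cancel_right]; exact hreg.lip0 θ hθ θ' hθ' x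
    have h2 := abs_mul_sub_mul_le (hreg.bound0 θ hθ x) (hb θ' hθ' x) h1 (hl θ hθ θ' hθ' x)
    rw [neg_sub_neg, abs_sub_comm]
    refine h2.trans ?_
    have : 0 ≤ m1 * ellNorm M (θ - θ') := by positivity
    nlinarith

theorem measure_hess_dev_gt_le (hM : M.PosDef) (hη : 0 < η) (hN : 1 ≤ N)
    (hreg : LocalRegularity F g0 M θs η k0 k1 k2 m0 m1 m2) (hu : 1 ≤ u) (hDu : (D : ℝ) ≤ u)
    {v w : E D} (hv : ‖v‖ ≤ 1) (hw : ‖w‖ ≤ 1) :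
    dataLaw PX g0 N {z | ∃ θ ∈ ellBall M θs η,
        84 * ((m2 + k0 * m2 + k2 * m0 + 2 * k1 * m1) * η + (k2 + k0 * k2 + k1 ^ 2)) * √N * √u
          < |empDev PX g0 (noiseAffine g0 (fun x => ⟪hessF F θ x v, w⟫)
        (fun x => -((F θ x - g0 x) * ⟪hessF F θ x v, w⟫
          + ⟪gradF F θ x, v⟫ * ⟪gradF F θ x, w⟫))) z|}
      ≤ ENNReal.ofReal (6 * Real.exp (-u)) := by
  have hg := g0.continuous.measurable
  have hk0 := hreg.k0_pos
  have hk1 := hreg.k1_pos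
  have hk2 := hreg.k2_pos
  have hm0 := hreg.m0_pos
  have hm1 := hreg.m1_pos
  have hm2 := hreg.m2_pos
  have hF : ∀ θ : E D, Measurable (F θ) := fun θ => (F θ).continuous.measurable
  have hc := center_mem_ellBall M θs hη
  have hb1 : ∀ v : E D, ‖v‖ ≤ 1 → ∀ θ ∈ ellBall M θs η, ∀ x, |⟪gradF F θ x, v⟫| ≤ k1 :=
    fun v hv θ hθ x => abs_inner_le_of_norm_le hv (hreg.bound1 θ hθ x)
  have hl1 : ∀ v : E D, ‖v‖ ≤ 1 → ∀ θ ∈ ellBall M θs η, ∀ θ' ∈ ellBall M θs η, ∀ x,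
      |⟪gradF F θ x, v⟫ - ⟪gradF F θ' x, v⟫| ≤ m1 * ellNorm M (θ - θ') :=
    fun v hv θ hθ θ' hθ' x => by
      rw [← inner_sub_left]
      exact abs_inner_le_of_norm_le hv (hreg.lip1 θ hθ θ' hθ' x)
  have hb2 : ∀ θ ∈ ellBall M θs η, ∀ x, |⟪hessF F θ x v, w⟫| ≤ k2 :=
    fun θ hθ x => abs_inner_apply_le_of_norm_le hv hw (hreg.bound2 θ hθ x)
  have hl2 : ∀ θ ∈ ellBall M θs η, ∀ θ' ∈ ellBall M θs η, ∀ x,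
      |⟪hessF F θ x v, w⟫ - ⟪hessF F θ' x v, w⟫| ≤ m2 * ellNorm M (θ - θ') :=
    fun θ hθ θ' hθ' x => by
      rw [← inner_sub_left, ← sub_apply]
      exact abs_inner_apply_le_of_norm_le hv hw (hreg.lip2 θ hθ θ' hθ' x)
  have hmH : ∀ θ ∈ ellBall M θs η, Measurable fun x => ⟪hessF F θ x v, w⟫ := fun θ hθ =>
    (measurable_hessF_apply hreg hθ v).inner measurable_const
  refine measure_exists_ellBall_empDev_gt_le hM hη hN (a := fun θ x => ⟪hessF F θ x v, w⟫)
    (b := fun θ x => -((F θ x - g0 x) * ⟪hessF F θ x v, w⟫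
          + ⟪gradF F θ x, v⟫ * ⟪gradF F θ x, w⟫)) hmH
    (fun θ hθ => ((((hF θ).sub hg).mul (hmH θ hθ)).add
      ((measurable_inner_gradF hreg hθ v).mul (measurable_inner_gradF hreg hθ w))).neg)
    (by positivity) (by positivity)
    (fun x => ?_) (fun x => ?_) (fun θ hθ θ' hθ' x => ?_) (fun θ hθ θ' hθ' x => ?_) hu hDu
  · have : 0 ≤ k0 * k2 + k1 ^ 2 := by positivity
    linarith [hb2 θs hc x]
  · rw [abs_neg]
    refine (abs_add_le _ _).trans ?_
    rw [abs_mul, abs_mul]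
    have h1 := mul_le_mul (hreg.bound0 θs hc x) (hb2 θs hc x) (abs_nonneg _) hk0.le
    have h2 := mul_le_mul (hb1 v hv θs hc x) (hb1 w hw θs hc x) (abs_nonneg _) hk1.le
    nlinarith
  · have h0 : 0 ≤ ellNorm M (θ - θ') := Real.sqrt_nonneg _
    refine (hl2 θ hθ θ' hθ' x).trans (mul_le_mul_of_nonneg_right ?_ h0)
    have : 0 ≤ k0 * m2 + k2 * m0 + 2 * k1 * m1 := by positivity
    linarith
  · have h0 : 0 ≤ ellNorm M (θ - θ') := Real.sqrt_nonneg _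
    have h1 : |(F θ x - g0 x) - (F θ' x - g0 x)| ≤ m0 * ellNorm M (θ - θ') := by
      rw [sub_sub_sub_cancel_right]; exact hreg.lip0 θ hθ θ' hθ' x
    have h2 := abs_mul_sub_mul_le (hreg.bound0 θ hθ x) (hb2 θ' hθ' x) h1 (hl2 θ hθ θ' hθ' x)
    have h3 := abs_mul_sub_mul_le (hb1 v hv θ hθ x) (hb1 w hw θ' hθ' x)
      (hl1 v hv θ hθ θ' hθ' x) (hl1 w hw θ hθ θ' hθ' x)
    rw [neg_sub_neg, abs_sub_comm, add_sub_add_comm]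
    refine (abs_add_le _ _).trans ?_
    have : 0 ≤ m2 * ellNorm M (θ - θ') := by positivity
    nlinarith

end Events

/-! ### The rate and the constants -/

section Rates

/-- The union bound over at most `25 ^ D` events is absorbed by the exponent `8 R`, since
`D ≤ R`. -/
theorem measure_biUnion_net_le {Ω ι : Type*} [MeasurableSpace Ω] {μ : Measure Ω} {S : Finset ι}
    {D : ℕ} {R : ℝ} (hS : S.card ≤ 5 ^ (2 * D)) (hD : 1 ≤ D) (hDR : (D : ℝ) ≤ R) {ev : ι → Set Ω}
    (h : ∀ s ∈ S, μ (ev s) ≤ ENNReal.ofReal (6 * Real.exp (-(8 * R)))) :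
    μ (⋃ s ∈ S, ev s) ≤ ENNReal.ofReal (8 * Real.exp (-R)) := by
  have hR : 1 ≤ R := le_trans (by exact_mod_cast hD) hDR
  calc _ ≤ ∑ s ∈ S, μ (ev s) := measure_biUnion_finset_le _ _
    _ ≤ ∑ _s ∈ S, ENNReal.ofReal (6 * Real.exp (-(8 * R))) := Finset.sum_le_sum h
    _ = ENNReal.ofReal (S.card * (6 * Real.exp (-(8 * R)))) := by
      rw [Finset.sum_const, nsmul_eq_mul, ← ENNReal.ofReal_natCast,
        ← ENNReal.ofReal_mul (by positivity)]
    _ ≤ _ := by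
      apply ENNReal.ofReal_le_ofReal
      have h1 : (S.card : ℝ) ≤ Real.exp (4 * R) := by
        refine (Nat.cast_le.2 hS).trans ?_
        push_cast
        refine (five_pow_le_exp _).trans (Real.exp_le_exp.2 ?_)
        push_cast; linarith
      calc _ ≤ Real.exp (4 * R) * (6 * Real.exp (-(8 * R))) := by gcongr
        _ = 6 * Real.exp (-(4 * R)) := by
          rw [mul_left_comm, ← Real.exp_add]; ring_nf
        _ ≤ 8 * Real.exp (-R) := by
          have : Real.exp (-(4 * R)) ≤ Real.exp (-R) := Real.exp_le_exp.2 (by linarith)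
          nlinarith [Real.exp_pos (-R)]

theorem sqrt_rate_mul_le {N R c G : ℝ} (hN : 0 ≤ N) (hc : 0 ≤ c) (hG : 0 < G)
    (h : R ≤ 1e-8 * N * (c ^ 2 / G ^ 2)) : √N * √(8 * R) * G ≤ 3e-4 * (N * c) := by
  rw [← Real.sqrt_mul hN]
  have h1 : √(N * (8 * R)) ≤ 3e-4 * (N * c) / G := by
    apply Real.sqrt_le_iff.2 ⟨by positivity, ?_⟩
    rw [div_pow]
    have h2 : N * (8 * R) ≤ N * (8 * (1e-8 * N * (c ^ 2 / G ^ 2))) := by gcongr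
    refine h2.trans ?_
    have : 0 ≤ N ^ 2 * (c ^ 2 / G ^ 2) := by positivity
    calc _ = 8e-8 * (N ^ 2 * (c ^ 2 / G ^ 2)) := by ring
      _ ≤ 9e-8 * (N ^ 2 * (c ^ 2 / G ^ 2)) := by gcongr; norm_num
      _ = _ := by ring
  calc _ ≤ 3e-4 * (N * c) / G * G := by gcongr
    _ = _ := by field_simp

/-- With the constant `10⁻⁸` in the rate, the threshold of the uniform deviation bound at `u = 8 R`
is at most `N c / 8`. The factor `2` in `hm` leaves room for the Lipschitz constant of
`⟪∇G, v⟫ ⟪∇G, w⟫`. -/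
theorem chaining_threshold_le {N R c G G' m κ η : ℝ} (hN : 0 ≤ N) (hc : 0 ≤ c) (hG : 0 < G)
    (hG' : 0 < G') (hη : 0 < η) (h : R ≤ 1e-8 * N * (c ^ 2 / (G ^ 2 * η ^ 2)))
    (h' : R ≤ 1e-8 * N * (c ^ 2 / G' ^ 2)) (hm : m ≤ 2 * G) (hκ : κ ≤ G') :
    84 * (m * η + κ) * √N * √(8 * R) ≤ N * c / 8 := by
  rw [← mul_pow] at h
  have h1 := sqrt_rate_mul_le hN hc (mul_pos hG hη) h
  have h2 := sqrt_rate_mul_le hN hc hG' h'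
  have h3 : 0 ≤ √N * √(8 * R) := by positivity
  have h4 : m * η + κ ≤ 2 * (G * η) + G' := by nlinarith
  have h5 : 0 ≤ N * c := by positivity
  calc _ = 84 * ((√N * √(8 * R)) * (m * η + κ)) := by ring
    _ ≤ 84 * ((√N * √(8 * R)) * (2 * (G * η) + G')) := by gcongr
    _ ≤ N * c / 8 := by nlinarith

end Rates

/-! ### Deviation events at the rate -/

section Main

variable {d D N : ℕ} {O : Set (EuclideanSpace ℝ (Fin d))} {PX : Measure O}
  [IsProbabilityMeasure PX] {g0 : C(O, ℝ)} {F : E D → C(O, ℝ)}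
  {M : Matrix (Fin D) (Fin D) ℝ} {θs : E D} {η k0 k1 k2 m0 m1 m2 cmin cmax R : ℝ}

theorem rateR_le {C : ℝ} (hC : 0 ≤ C) :
    rateR C N η k0 k1 k2 m0 m1 m2 cmin cmax
        ≤ C * N * (cmin ^ 2 / ((CG k0 k1 k2 m0 m1 m2) ^ 2 * η ^ 2)) ∧
    rateR C N η k0 k1 k2 m0 m1 m2 cmin cmax ≤ C * N * (cmin ^ 2 / (CG' k0 k1 k2) ^ 2) ∧
    rateR C N η k0 k1 k2 m0 m1 m2 cmin cmax
        ≤ C * N * (cmax ^ 2 / ((CG'' k0 k1 m0 m1) ^ 2 * η ^ 2)) ∧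
    rateR C N η k0 k1 k2 m0 m1 m2 cmin cmax ≤ C * N * (cmax ^ 2 / (CG''' k0 k1) ^ 2) := by
  unfold rateR
  have hCN : 0 ≤ C * (N : ℝ) := by positivity
  refine ⟨?_, ?_, ?_, ?_⟩ <;> refine mul_le_mul_of_nonneg_left ?_ hCN <;> simp

theorem measure_opNorm_hess_dev_gt_le (hM : M.PosDef) (hη : 0 < η) (hN : 1 ≤ N) (hD : 1 ≤ D)
    (hreg : LocalRegularity F g0 M θs η k0 k1 k2 m0 m1 m2) (hc : 0 < cmin) (hDR : (D : ℝ) ≤ R)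
    (h1 : R ≤ 1e-8 * N * (cmin ^ 2 / ((CG k0 k1 k2 m0 m1 m2) ^ 2 * η ^ 2)))
    (h2 : R ≤ 1e-8 * N * (cmin ^ 2 / (CG' k0 k1 k2) ^ 2)) :
    dataLaw PX g0 N {z | ∃ θ ∈ ellBall M θs η,
        N * cmin / 2 < ‖hess (fun t => logLikN F t z) θ
          - (N : ℝ) • ∫ w, hess (fun t => logLik F t w) θ ∂(obsLaw PX g0)‖}
      ≤ ENNReal.ofReal (8 * Real.exp (-R)) := by
  have hk0 := hreg.k0_pos
  have hk1 := hreg.k1_pos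
  have hk2 := hreg.k2_pos
  have hm0 := hreg.m0_pos
  have hm1 := hreg.m1_pos
  have hm2 := hreg.m2_pos
  have hR : 1 ≤ R := le_trans (by exact_mod_cast hD) hDR
  obtain ⟨S, hcard, hS1, hnet⟩ := exists_half_net (E D)
  rw [finrank_euclideanSpace_fin] at hcard
  have hthr := chaining_threshold_le (m := m2 + k0 * m2 + k2 * m0 + 2 * k1 * m1)
    (κ := k2 + k0 * k2 + k1 ^ 2) (by positivity) hc.le (by unfold CG; positivity)
    (by unfold CG'; positivity) hη h1 h2
    (by unfold CG; nlinarith [mul_pos hk0 hm2, mul_pos hk2 hm0]) (by unfold CG'; linarith)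
  refine le_trans (measure_mono ?_) (measure_biUnion_net_le (S := S ×ˢ S) ?_ hD hDR
    fun vw hvw => measure_hess_dev_gt_le hM hη hN hreg (u := 8 * R) (by linarith) (by linarith)
      (hS1 vw.1 (Finset.mem_product.1 hvw).1) (hS1 vw.2 (Finset.mem_product.1 hvw).2))
  · intro z hz
    rw [Set.mem_ofPred_eq] at hz
    obtain ⟨θ, hθ, hz⟩ := hz
    by_contra hcon
    simp only [Set.mem_iUnion, Set.mem_ofPred_eq, not_exists, not_and, not_lt] at hcon
    refine absurd hz (not_lt.2 ?_)
    have := opNorm_le_of_net hnet (A := hess (fun t => logLikN F t z) θ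
      - (N : ℝ) • ∫ w, hess (fun t => logLik F t w) θ ∂(obsLaw PX g0)) (m := N * cmin / 8)
      (fun s hs t ht => by
        rw [inner_hess_dev hreg hθ]
        exact (hcon (s, t) (Finset.mem_product.2 ⟨hs, ht⟩) θ hθ).trans hthr)
    linarith
  · rw [Finset.card_product]
    calc _ ≤ 5 ^ D * 5 ^ D := Nat.mul_le_mul hcard hcard
      _ = _ := by rw [← pow_add, two_mul]

theorem measure_norm_gradient_dev_gt_le (hM : M.PosDef) (hη : 0 < η) (hN : 1 ≤ N) (hD : 1 ≤ D)
    (hreg : LocalRegularity F g0 M θs η k0 k1 k2 m0 m1 m2) (hc : 0 < cmax) (hDR : (D : ℝ) ≤ R)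
    (h1 : R ≤ 1e-8 * N * (cmax ^ 2 / ((CG'' k0 k1 m0 m1) ^ 2 * η ^ 2)))
    (h2 : R ≤ 1e-8 * N * (cmax ^ 2 / (CG''' k0 k1) ^ 2)) :
    dataLaw PX g0 N {z | ∃ θ ∈ ellBall M θs η,
        N * cmax / 4 < ‖gradient (fun t => logLikN F t z) θ
          - (N : ℝ) • ∫ w, gradient (fun t => logLik F t w) θ ∂(obsLaw PX g0)‖}
      ≤ ENNReal.ofReal (8 * Real.exp (-R)) := by
  have hk0 := hreg.k0_pos
  have hk1 := hreg.k1_pos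
  have hm0 := hreg.m0_pos
  have hm1 := hreg.m1_pos
  have hR : 1 ≤ R := le_trans (by exact_mod_cast hD) hDR
  obtain ⟨S, hcard, hS1, hnet⟩ := exists_half_net (E D)
  rw [finrank_euclideanSpace_fin] at hcard
  have hthr := chaining_threshold_le (m := m1 + k0 * m1 + k1 * m0)
    (κ := k1 + k0 * k1) (by positivity) hc.le (by unfold CG''; positivity)
    (by unfold CG'''; positivity) hη h1 h2
    (by unfold CG''; nlinarith [mul_pos hk0 hm1, mul_pos hk1 hm0, mul_pos hk0 hm0])
    (by unfold CG'''; nlinarith)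
  refine le_trans (measure_mono ?_) (measure_biUnion_net_le (S := S) ?_ hD hDR
    fun v hv => measure_gradient_dev_gt_le hM hη hN hreg (u := 8 * R) (by linarith) (by linarith)
      (hS1 v hv))
  · intro z hz
    rw [Set.mem_ofPred_eq] at hz
    obtain ⟨θ, hθ, hz⟩ := hz
    by_contra hcon
    simp only [Set.mem_iUnion, Set.mem_ofPred_eq, not_exists, not_and, not_lt] at hcon
    refine absurd hz (not_lt.2 ?_)
    have := norm_le_of_net hnet (x := gradient (fun t => logLikN F t z) θ
      - (N : ℝ) • ∫ w, gradient (fun t => logLik F t w) θ ∂(obsLaw PX g0)) (m := N * cmax / 8)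
      (fun s hs => by
        rw [inner_gradient_dev hreg hθ]
        exact (hcon s hs θ hθ).trans hthr)
    linarith
  · exact hcard.trans (Nat.pow_le_pow_right (by norm_num) (by omega))

theorem measure_abs_logLik_dev_gt_le (hM : M.PosDef) (hη : 0 < η) (hN : 1 ≤ N) (hD : 1 ≤ D)
    (hreg : LocalRegularity F g0 M θs η k0 k1 k2 m0 m1 m2) (hc : 0 < cmax) (hDR : (D : ℝ) ≤ R)
    (h1 : R ≤ 1e-8 * N * (cmax ^ 2 / ((CG'' k0 k1 m0 m1) ^ 2 * η ^ 2)))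
    (h2 : R ≤ 1e-8 * N * (cmax ^ 2 / (CG''' k0 k1) ^ 2)) :
    dataLaw PX g0 N {z | ∃ θ ∈ ellBall M θs η,
        N * cmax / 8 < |empDev PX g0 (noiseAffine g0 (fun x => F θ x - g0 x)
            (fun x => -(1 / 2) * (F θ x - g0 x) ^ 2)) z|}
      ≤ ENNReal.ofReal (8 * Real.exp (-R)) := by
  have hk0 := hreg.k0_pos
  have hk1 := hreg.k1_pos
  have hm0 := hreg.m0_pos
  have hm1 := hreg.m1_pos
  have hR : 1 ≤ R := le_trans (by exact_mod_cast hD) hDR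
  have hthr := chaining_threshold_le (m := k0 * m0 + m0)
    (κ := k0 ^ 2 + k0) (by positivity) hc.le (by unfold CG''; positivity)
    (by unfold CG'''; positivity) hη h1 h2
    (by unfold CG''; nlinarith [mul_pos hk0 hm1, mul_pos hk1 hm0, mul_pos hk0 hm0])
    (by unfold CG'''; nlinarith [mul_pos hk0 hk1])
  refine le_trans (measure_mono ?_) ((measure_logLik_dev_gt_le hM hη hN hreg (u := 8 * R)
    (by linarith) (by linarith)).trans (ENNReal.ofReal_le_ofReal ?_))
  · intro z hz
    rw [Set.mem_ofPred_eq] at hz ⊢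
    obtain ⟨θ, hθ, hz⟩ := hz
    exact ⟨θ, hθ, hthr.trans_lt hz⟩
  · have : Real.exp (-(8 * R)) ≤ Real.exp (-R) := Real.exp_le_exp.2 (by linarith)
    nlinarith [Real.exp_pos (-R)]

/-- If the Hessian of `ℓ_N` is within `N c_min / 2` of its mean, the curvature of the mean carries
over with half the constant. -/
theorem le_lambdaMin_neg_hess_logLikN (hD : 1 ≤ D)
    (hreg : LocalRegularity F g0 M θs η k0 k1 k2 m0 m1 m2)
    (hcurv : LocalCurvature PX F g0 M θs η cmin cmax) {θ : E D} (hθ : θ ∈ ellBall M θs η)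
    {z : Fin N → ℝ × O}
    (h : ‖hess (fun t => logLikN F t z) θ
          - (N : ℝ) • ∫ w, hess (fun t => logLik F t w) θ ∂(obsLaw PX g0)‖ ≤ N * cmin / 2) :
    1 / 2 * N * cmin ≤ lambdaMin (-hess (fun t => logLikN F t z) θ) := by
  have : NeZero D := ⟨by omega⟩
  set H := ∫ w, hess (fun t => logLik F t w) θ ∂(obsLaw PX g0) with hH
  have hl := hcurv.lower θ hθ
  rw [integral_neg, ← hH] at hl
  refine le_lambdaMin (fun v w => ?_) fun v hv => ?_
  · simp only [neg_apply, inner_neg_left, inner_neg_right,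
      hess_symm (contDiffAt_logLikN hreg hθ z) v w]
  · have h1 := lambdaMin_le_inner (A := -H) (fun v w => by
      simp only [neg_apply, inner_neg_left, inner_neg_right]
      rw [integral_hess_symm hreg hθ v w]) hv
    have h2 := abs_inner_apply_le_of_norm_le hv.le hv.le h
    simp only [sub_apply, smul_apply, inner_sub_left, inner_smul_left, conj_trivial] at h2
    simp only [neg_apply, inner_neg_left] at h1 ⊢
    have h3 := le_of_abs_le h2
    have h4 : (N : ℝ) * cmin ≤ N * -⟪H v, v⟫ := by
      have := hl.trans h1
      gcongr
    linarith

theorem norm_le_add_of_norm_sub_smul_le {W : Type*} [NormedAddCommGroup W] [NormedSpace ℝ W]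
    {x e : W} {n c : ℝ} (hn : 0 ≤ n) (h : ‖x - n • e‖ ≤ c) : ‖x‖ ≤ n * ‖e‖ + c := by
  have h1 := norm_sub_norm_le x (n • e)
  rw [norm_smul, Real.norm_of_nonneg hn] at h1
  linarith

end Main

end RandomDesign

end

open RandomDesign in
theorem lemma3p4 :
    ∃ C : ℝ, 0 < C ∧
      ∀ (d : ℕ) (O : Set (EuclideanSpace ℝ (Fin d))) (_hO : MeasurableSet O)
        (PX : Measure O) (_hPX : IsProbabilityMeasure PX)
        (Θ : Submodule ℝ EllTwo) (G : Θ → C(O, ℝ)) (θ0 : Θ)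
        (D N : ℕ) (_hD : 1 ≤ D) (_hN : 1 ≤ N)
        -- the inclusion of `ℝ^D` as a linear subspace of `Θ`
        (ι : E D →ₗ[ℝ] Θ) (_hι : Function.Injective ι)
        (M : Matrix (Fin D) (Fin D) ℝ) (_hM : M.PosDef) (θs : E D) (η : ℝ) (_hη : 0 < η)
        (k0 k1 k2 m0 m1 m2 cmin cmax : ℝ)
        (_hreg : LocalRegularity (fun θ => G (ι θ)) (G θ0) M θs η k0 k1 k2 m0 m1 m2)
        (_hcurv : LocalCurvature PX (fun θ => G (ι θ)) (G θ0) M θs η cmin cmax)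
        (_hDR : (D : ℝ) ≤ rateR C N η k0 k1 k2 m0 m1 m2 cmin cmax),
        -- an infimum over `B` is `< a` iff some value is `< a`; likewise for the supremum
        (dataLaw PX (G θ0) N).real
            {z | ∃ θ ∈ ellBall M θs η,
              lambdaMin (-hess (fun t => logLikN (fun θ => G (ι θ)) t z) θ) < 1 / 2 * N * cmin}
          ≤ 8 * Real.exp (-rateR C N η k0 k1 k2 m0 m1 m2 cmin cmax) ∧
        (dataLaw PX (G θ0) N).real
            {z | ∃ θ ∈ ellBall M θs η,
              |logLikN (fun θ => G (ι θ)) θ z|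
                + ‖gradient (fun t => logLikN (fun θ => G (ι θ)) t z) θ‖
                + ‖hess (fun t => logLikN (fun θ => G (ι θ)) t z) θ‖ > N * (5 * cmax + 1)}
          ≤ 24 * Real.exp (-rateR C N η k0 k1 k2 m0 m1 m2 cmin cmax)
            + Real.exp (-(N : ℝ) / 8) := by
  refine ⟨1e-8, by norm_num, ?_⟩
  intro d O _ PX _ Θ G θ0 D N hD hN ι _ M hM θs η hη k0 k1 k2 m0 m1 m2 cmin cmax hreg hcurv hDR
  obtain ⟨h1, h2, h3, h4⟩ := rateR_le (N := N) (η := η) (k0 := k0) (k1 := k1) (k2 := k2)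
    (m0 := m0) (m1 := m1) (m2 := m2) (cmin := cmin) (cmax := cmax) (C := 1e-8) (by norm_num)
  set R := rateR 1e-8 N η k0 k1 k2 m0 m1 m2 cmin cmax
  have hcmin := hcurv.cmin_pos
  have hcc := hcurv.cmin_le_cmax
  have hcmax : 0 < cmax := hcmin.trans_le hcc
  have hHess := measure_opNorm_hess_dev_gt_le (PX := PX) hM hη hN hD hreg hcmin hDR h1 h2
  have hGrad := measure_norm_gradient_dev_gt_le (PX := PX) hM hη hN hD hreg hcmax hDR h3 h4
  have hLik := measure_abs_logLik_dev_gt_le (PX := PX) hM hη hN hD hreg hcmax hDR h3 h4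
  have hChi := measure_sum_noise_sq_gt_le (PX := PX) (g0 := G θ0) N
  have hN0 : (0 : ℝ) ≤ N := by positivity
  constructor
  · refine ENNReal.toReal_le_of_le_ofReal (by positivity)
      ((measure_mono fun z hz => ?_).trans hHess)
    rw [Set.mem_ofPred_eq] at hz ⊢
    obtain ⟨θ, hθ, hz⟩ := hz
    refine ⟨θ, hθ, ?_⟩
    by_contra! hcon
    exact absurd (le_lambdaMin_neg_hess_logLikN hD hreg hcurv hθ hcon) (not_le.2 hz)
  · -- off the four exceptional events the deviations add up to at most
    -- `N c_max / 8 + N + N c_max / 4 + N c_min / 2`, on top of the means `N c_max`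
    refine ENNReal.toReal_le_of_le_ofReal (by positivity) ?_
    refine (measure_mono (fun z hz => ?_)).trans ((measure_union_le _ _).trans
      ((add_le_add ((measure_union_le _ _).trans (add_le_add ((measure_union_le _ _).trans
        (add_le_add hHess hGrad)) hLik)) hChi).trans_eq ?_))
    · by_contra hcon
      simp only [Set.mem_union, Set.mem_ofPred_eq, not_or, not_exists, not_and, not_lt] at hcon hz
      obtain ⟨⟨⟨c1, c2⟩, c3⟩, c4⟩ := hcon
      obtain ⟨θ, hθ, hz⟩ := hz
      have e1 := norm_le_add_of_norm_sub_smul_le hN0 (c1 θ hθ)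
      have e2 := norm_le_add_of_norm_sub_smul_le hN0 (c2 θ hθ)
      have e3 : |logLikN (fun θ => G (ι θ)) θ z| ≤
          N * |∫ w, logLik (fun θ => G (ι θ)) θ w ∂(obsLaw PX (G θ0))| + (N * cmax / 8 + N) := by
        refine norm_le_add_of_norm_sub_smul_le (W := ℝ) hN0 ?_
        rw [smul_eq_mul, logLikN_dev hreg hθ z, Real.norm_eq_abs]
        refine (abs_sub _ _).trans (add_le_add (c3 θ hθ) ?_)
        have : 0 ≤ ∑ i, ((z i).1 - G θ0 (z i).2) ^ 2 := Finset.sum_nonneg fun i _ => sq_nonneg _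
        rw [abs_le]
        constructor <;> linarith
      have e4 := mul_le_mul_of_nonneg_left (hcurv.upper θ hθ) hN0
      have e5 := mul_le_mul_of_nonneg_left hcc hN0
      have e6 : 0 ≤ N * cmax := by positivity
      nlinarith
    · rw [← ENNReal.ofReal_add (by positivity) (by positivity),
        ← ENNReal.ofReal_add (by positivity) (by positivity),
        ← ENNReal.ofReal_add (by positivity) (by positivity)]
      ring_nf
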